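/- Let $d\in\mathbb N$, $\xi>0$, and let $G_\xi(dm)=\xi m^{-\xi-1}\,dm$ on $(0,\infty)$. Let $h:\mathbb R^d\to[0,+\infty]$ be continuous with $$\int_{\mathbb R^d}h(x)^\xi\,dx=1\quad\text{and}\quad \int_{\mathbb R^d}h^+(x)^\xi\,dx<\infty,\qquad h^+(x)=\sup_{|z|\le 1}h(x+z).$$ Let $\Phi_\infty$ be a Poisson point process on $\mathbb R^d\times(0,\infty)$ with intensity measure $dx\,G_\xi(dm)$, defined on a probability space $(\Omega,\mathcal F,\mathbb P)$. For a point $\phi=(x_\phi,m_\phi)$ put $h_\phi(y)=m_\phi h(y-x_\phi)$, and let $M_\infty(y)=\sup\{h_\phi(y):\phi\in\Phi_\infty\}$, $y\in\mathbb R^d$. A point $\phi\in\Phi_\infty$ is called extremal if $M_\infty(y)=h_\phi(y)$ for some $y\in\mathbb R^d$; let $\tilde\Phi_\infty\subset\Phi_\infty$ be the set of extremal points. Then $\tilde\Phi_\infty$ is (up to $\mathbb P$-null sets) a stationary marked point process on $\mathbb R^d\times(0,\infty)$: it is a random locally finite subset, almost surely only finitely many of its points have their location in any given bounded subset of $\mathbb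 R^d$, and for all $z\in\mathbb R^d$ the translate $\{(x+z,m):(x,m)\in\tilde\Phi_\infty\}$ has the same law as $\tilde\Phi_\infty$. Moreover $$\tilde\lambda=\int_0^\infty\bigl(1-\mathbb P(M_\infty\ge mh)\bigr)\,G_\xi(dm)$$ satisfies $0<\tilde\lambda<\infty$, where $M_\infty\ge mh$ means $M_\infty(y)\ge m h(y)$ for all $y\in\mathbb R^d$; $$\nu(dm)=\tilde\lambda^{-1}\bigl(1-\mathbb P(M_\infty\ge mh)\bigr)\,G_\xi(dm)$$ is a probability measure on $(0,\infty)$; and the Campbell measure $C(A)=\mathbb E\bigl[\#(\tilde\Phi_\infty\cap A)\bigr]$ of $\tilde\Phi_\infty$ is $$C(dx,dm)=\tilde\lambda\,dx\,\nu(dm).$$ That is, $\tilde\Phi_\infty$ has intensity $\tilde\lambda$ and Palm mark distribution $\nu$. -/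

import Mathlib

open MeasureTheory ProbabilityTheory
open scoped ENNReal

noncomputable section

namespace ExtremalShotNoise

/-- The locally finite subsets of a topological space: each compact set contains only finitely
many of their points. -/
def Config (X : Type*) [TopologicalSpace X] : Type _ :=
  {s : Set X // ∀ K : Set X, IsCompact K → (s ∩ K).Finite}

namespace Config

variable {X : Type*} [TopologicalSpace X]

/-- The number of points of the configuration `s` in the set `A`. -/
def count (A : Set X) (s : Config X) : ℕ∞ := (s.1 ∩ A).encard

/-- The σ-field on configurations generated by the counts of the points in Borel sets. -/
instance [MeasurableSpace X] : MeasurableSpace (Config X) :=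
  ⨆ (A : Set X) (_ : MeasurableSet A), MeasurableSpace.comap (count A) inferInstance

end Config

/-- The space `ℝ^d`. -/
abbrev Loc (d : ℕ) : Type := EuclideanSpace ℝ (Fin d)

/-- The space of marks `(0, ∞)`. -/
abbrev Mark : Type := Set.Ioi (0 : ℝ)

/-- The translate `{(x + z, m) : (x, m) ∈ s}` of a configuration of marked points. -/
def Config.translate {d : ℕ} (z : Loc d) (s : Config (Loc d × Mark)) : Config (Loc d × Mark) :=
  ⟨(fun φ : Loc d × Mark => (φ.1 + z, φ.2)) '' s.1, by
    intro K hK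
    have hc : Continuous (fun φ : Loc d × Mark => (φ.1 - z, φ.2)) := by fun_prop
    refine ((s.2 _ (hK.image hc)).image (fun φ : Loc d × Mark => (φ.1 + z, φ.2))).subset ?_
    rintro _ ⟨⟨φ, hφ, rfl⟩, hφK⟩
    exact ⟨φ, ⟨hφ, ⟨_, hφK, by simp⟩⟩, rfl⟩⟩

/-- `Φ` is a Poisson point process on `X` with intensity measure `μ`. -/
structure IsPoissonPointProcess {Ω X : Type*} [MeasurableSpace Ω] [TopologicalSpace X]
    [MeasurableSpace X] (P : Measure Ω) (μ : Measure X) (Φ : Ω → Config X) : Prop where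
  measurable : Measurable Φ
  poisson : ∀ A : Set X, MeasurableSet A → μ A ≠ ∞ →
    P.map (fun ω => (Φ ω).count A) =
      (poissonMeasure (μ A).toNNReal).map (fun k : ℕ => (k : ℕ∞))
  indep : ∀ (n : ℕ) (A : Fin n → Set X), (∀ i, MeasurableSet (A i)) →
    Pairwise (Function.onFun Disjoint A) → iIndepFun (fun i ω => (Φ ω).count (A i)) P

/-- `Ψ` is a stationary marked point process with locations in `ℝ^d` and marks in `(0, ∞)`:
a random configuration, with almost surely finitely many points (whatever their marks) above each
bounded set of locations, whose law is invariant under translations of the locations. -/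
structure IsStationaryMarkedPointProcess {Ω : Type*} [MeasurableSpace Ω] {d : ℕ}
    (P : Measure Ω) (Ψ : Ω → Config (Loc d × Mark)) : Prop where
  aemeasurable : AEMeasurable Ψ P
  ground_locallyFinite : ∀ᵐ ω ∂P, ∀ B : Set (Loc d), Bornology.IsBounded B →
    ((Ψ ω).1 ∩ B ×ˢ Set.univ).Finite
  stationary : ∀ z : Loc d, IdentDistrib (fun ω => (Ψ ω).translate z) Ψ P P

/-- The Campbell measure `C(A) = 𝔼[#{φ ∈ Ψ : φ ∈ A}]`, as a function of the set `A`. -/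
def campbell {Ω X : Type*} [MeasurableSpace Ω] [TopologicalSpace X]
    (P : Measure Ω) (Ψ : Ω → Config X) (A : Set X) : ℝ≥0∞ :=
  ∫⁻ ω, ((Ψ ω).count A : ℝ≥0∞) ∂P

/-- The measure `G_ξ(dm) = ξ m^(-ξ-1) dm` on `(0, ∞)`. -/
def Gξ (ξ : ℝ) : Measure Mark :=
  ((volume : Measure ℝ).comap ((↑) : Mark → ℝ)).withDensity fun m =>
    ENNReal.ofReal (ξ * (m : ℝ) ^ (-ξ - 1))

variable {d : ℕ}

/-- `h⁺(x) = sup {h(x + z) : |z| ≤ 1}`. -/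
def hPlus (h : Loc d → ℝ≥0∞) (x : Loc d) : ℝ≥0∞ := ⨆ (z : Loc d) (_ : ‖z‖ ≤ 1), h (x + z)

/-- `h_φ(y) = m h(y - x)` for the marked point `φ = (x, m)`. -/
def shot (h : Loc d → ℝ≥0∞) (φ : Loc d × Mark) (y : Loc d) : ℝ≥0∞ :=
  ENNReal.ofReal (φ.2 : ℝ) * h (y - φ.1)

/-- The extremal shot noise `M(y) = sup {h_φ(y) : φ ∈ s}`. -/
def shotNoise (h : Loc d → ℝ≥0∞) (s : Config (Loc d × Mark)) (y : Loc d) : ℝ≥0∞ :=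
  ⨆ φ ∈ s.1, shot h φ y

/-- The extremal points of `s`: those whose function attains the extremal shot noise somewhere. -/
def extremal (h : Loc d → ℝ≥0∞) (s : Config (Loc d × Mark)) : Config (Loc d × Mark) :=
  ⟨{φ ∈ s.1 | ∃ y, shotNoise h s y = shot h φ y}, fun K hK =>
    (s.2 K hK).subset fun _ hφ => ⟨hφ.1.1, hφ.2⟩⟩

variable {Ω : Type*} [MeasurableSpace Ω]

/-- `1 - ℙ(M ≥ m h)`, where `M ≥ m h` means that `M(y) ≥ m h(y)` for all `y`. -/
def exceedProb (P : Measure Ω) (h : Loc d → ℝ≥0∞) (Φ : Ω → Config (Loc d × Mark)) (m : Mark) :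
    ℝ≥0∞ :=
  1 - P {ω | ∀ y, ENNReal.ofReal (m : ℝ) * h y ≤ shotNoise h (Φ ω) y}

/-- `∫ (1 - ℙ(M ≥ m h)) G_ξ(dm)`. -/
def extremalIntensity (P : Measure Ω) (ξ : ℝ) (h : Loc d → ℝ≥0∞)
    (Φ : Ω → Config (Loc d × Mark)) : ℝ≥0∞ :=
  ∫⁻ m, exceedProb P h Φ m ∂(Gξ ξ)

/-- `ν(dm) = (∫ (1 - ℙ(M ≥ m' h)) G_ξ(dm'))⁻¹ (1 - ℙ(M ≥ m h)) G_ξ(dm)`. -/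
def extremalMarkLaw (P : Measure Ω) (ξ : ℝ) (h : Loc d → ℝ≥0∞)
    (Φ : Ω → Config (Loc d × Mark)) : Measure Mark :=
  (extremalIntensity P ξ h Φ)⁻¹ • (Gξ ξ).withDensity (exceedProb P h Φ)

end ExtremalShotNoise

end

/-!
The Mecke equation writes the Campbell measure of the extremal points as
`∫ ℙ(h_φ touches M) dx G_ξ(dm)`, where `h_φ` touches the extremal shot noise `M` of the
whole process if `M ≤ h_φ` at some point, and exceeds it if `M < h_φ` at some point. Since `M` is
positive, raising the mark of a touching function makes it exceed, so above a given location at most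
one mark touches without exceeding. Hence touching may be replaced by exceeding, which has
probability `1 - ℙ(M ≥ m h)` by translation invariance.

The intensity is finite since, for a function `g` with `g ≤ h (· + z)` for all small `z`, the
function `m h⁺` is at least the shot noise `M_g` on a ball whenever `m h` exceeds `M` at its centre.
Integration over the centre bounds the intensity by a multiple of
`∫ ∫ ℙ(M_g(y) ≤ m h⁺(y)) G_ξ(dm) dy`, which is explicit because `M_g` has Fréchet marginals.
-/

namespace ExtremalShotNoise

open TopologicalSpace in
lemma exists_lt_iff_denseSeq {Y R : Type*} [TopologicalSpace Y] [SeparableSpace Y] [Nonempty Y]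
    [TopologicalSpace R] [LinearOrder R] [OrderClosedTopology R] {f g : Y → R}
    (hf : Continuous f) (hg : Continuous g) :
    (∃ y, f y < g y) ↔ ∃ i, f (denseSeq Y i) < g (denseSeq Y i) := by
  refine ⟨fun ⟨y, hy⟩ => ?_, fun ⟨i, hi⟩ => ⟨_, hi⟩⟩
  exact (denseRange_denseSeq Y).exists_mem_open (isOpen_lt hf hg) ⟨y, hy⟩

open TopologicalSpace in
lemma exists_le_iff_denseSeq {Y : Type*} [PseudoMetricSpace Y] [ProperSpace Y] [Nonempty Y]
    {f g : Y → ℝ≥0∞} (hf : Continuous f) (hg : Continuous g) (hg_top : ∀ y, g y ≠ ∞) (y₀ : Y) :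
    (∃ y, f y ≤ g y) ↔ ∃ n : ℕ, ∀ k : ℕ, ∃ i, denseSeq Y i ∈ Metric.ball y₀ n ∧
      f (denseSeq Y i) < g (denseSeq Y i) + (k : ℝ≥0∞)⁻¹ := by
  constructor
  · rintro ⟨y, hy⟩
    obtain ⟨n, hn⟩ := exists_nat_gt (dist y y₀)
    refine ⟨n, fun k => (denseRange_denseSeq Y).exists_mem_open
      (Metric.isOpen_ball.inter (isOpen_lt hf (hg.add continuous_const))) ⟨y, hn, ?_⟩⟩
    exact hy.trans_lt (ENNReal.lt_add_right (hg_top y) (by simp))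
  · rintro ⟨n, hn⟩
    choose i hi hlt using hn
    obtain ⟨y, -, u, hu, hlim⟩ := (isCompact_closedBall y₀ (n : ℝ)).tendsto_subseq
      fun k => Metric.ball_subset_closedBall (hi k)
    have hg_lim : Filter.Tendsto (fun k => g (denseSeq Y (i (u k))) + (u k : ℝ≥0∞)⁻¹)
        Filter.atTop (nhds (g y + 0)) :=
      ((hg.tendsto y).comp hlim).add
        (ENNReal.tendsto_inv_nat_nhds_zero.comp hu.tendsto_atTop)
    rw [add_zero] at hg_lim
    exact ⟨y, le_of_tendsto_of_tendsto' ((hf.tendsto y).comp hlim) hg_lim fun k => (hlt (u k)).le⟩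

lemma measurable_of_measurable_toENNReal {Y : Type*} [MeasurableSpace Y] {f : Y → ℕ∞}
    (hf : Measurable fun y => (f y : ℝ≥0∞)) : Measurable f := by
  refine measurable_to_countable' fun k => ?_
  have hk : f ⁻¹' {k} = (fun y => (f y : ℝ≥0∞)) ⁻¹' {(k : ℝ≥0∞)} := by
    ext y; simp
  exact hk ▸ hf (measurableSet_singleton _)

lemma isSFiniteKernel_of_forall_isFiniteMeasure {Y Z : Type*} [MeasurableSpace Y]
    [MeasurableSpace Z] (κ : Kernel Y Z) [∀ y, IsFiniteMeasure (κ y)] : IsSFiniteKernel κ := by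
  classical
  let E (j : ℕ) : Set Y := {y | ⌊(κ y Set.univ).toReal⌋₊ = j}
  have hE (j : ℕ) : MeasurableSet (E j) :=
    (Nat.measurable_floor.comp (κ.measurable_coe .univ).ennreal_toReal) (measurableSet_singleton j)
  have hfin (j : ℕ) : IsFiniteKernel (Kernel.piecewise (hE j) κ 0) := by
    refine ⟨⟨ENNReal.ofReal (j + 1), ENNReal.ofReal_lt_top, fun y => ?_⟩⟩
    rw [Kernel.piecewise_apply]
    split_ifs with hy
    · rw [← ENNReal.ofReal_toReal (measure_ne_top (κ y) .univ), ← show _ = j from hy]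
      exact ENNReal.ofReal_le_ofReal (Nat.lt_floor_add_one _).le
    · simp
  have hsum : κ = Kernel.sum fun j => Kernel.piecewise (hE j) κ 0 := by
    ext y A hA
    rw [Kernel.sum_apply' _ _ hA, tsum_eq_single ⌊(κ y Set.univ).toReal⌋₊ fun j hj => ?_]
    · rw [Kernel.piecewise_apply, if_pos (by exact rfl)]
    · rw [Kernel.piecewise_apply, if_neg (by exact hj.symm)]; simp
  rw [hsum]
  exact Kernel.isSFiniteKernel_sum

lemma exists_disjoint_refinement {X ι : Type*} [MeasurableSpace X] [Finite ι] {B : ι → Set X}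
    (hB : ∀ i, MeasurableSet (B i)) :
    ∃ (n : ℕ) (C : Fin n → Set X), (∀ j, MeasurableSet (C j)) ∧
      Pairwise (Function.onFun Disjoint C) ∧ (∀ j, ∃ i, C j ⊆ B i) ∧
      ∀ i, ∃ T : Finset (Fin n), B i = ⋃ j ∈ T, C j := by
  classical
  have := Fintype.ofFinite ι
  let e := Fintype.equivFin {S : Finset ι // S.Nonempty}
  let atom (S : Finset ι) : Set X := {x | ∀ i, x ∈ B i ↔ i ∈ S}
  refine ⟨_, fun j => atom (e.symm j), fun j => ?_, fun j k hjk => ?_, fun j => ?_, fun i => ?_⟩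
  · simp only [atom, Set.ofPred_forall]
    exact MeasurableSet.iInter fun i => (hB i).iff (MeasurableSet.const _)
  · refine Set.disjoint_left.2 fun x hj hk => hjk (e.symm.injective (Subtype.ext ?_))
    ext i
    rw [← hj i, hk i]
  · obtain ⟨i, hi⟩ := (e.symm j).2
    exact ⟨i, fun x hx => (hx i).2 hi⟩
  · refine ⟨Finset.univ.filter fun j => i ∈ (e.symm j).1, Set.Subset.antisymm (fun x hx => ?_) ?_⟩
    · let S : {S : Finset ι // S.Nonempty} := ⟨Finset.univ.filter fun k => x ∈ B k, i, by simpa⟩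
      exact Set.mem_biUnion (x := e S) (by simpa [S] using hx) (by simp [atom, S])
    · exact Set.iUnion₂_subset fun j hj x hx => (hx i).2 (by simpa using hj)

namespace Config

variable {X : Type*} [TopologicalSpace X]

lemma count_mono (s : Config X) {A B : Set X} (hAB : A ⊆ B) : s.count A ≤ s.count B :=
  Set.encard_le_encard (Set.inter_subset_inter_right _ hAB)

lemma count_ne_top_of_isCompact (s : Config X) {K : Set X} (hK : IsCompact K) :
    s.count K ≠ ⊤ :=
  Set.encard_ne_top_iff.2 (s.2 K hK)

lemma count_biUnion_finset {ι : Type*} (s : Config X) {T : Finset ι} {A : ι → Set X}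
    (hA : (T : Set ι).PairwiseDisjoint A) : s.count (⋃ i ∈ T, A i) = ∑ i ∈ T, s.count (A i) := by
  classical
  induction T using Finset.induction_on with
  | empty => simp [count]
  | insert i T hi ih =>
    rw [Finset.coe_insert, Set.pairwiseDisjoint_insert_of_notMem (by simpa using hi)] at hA
    rw [Finset.set_biUnion_insert, Finset.sum_insert hi, ← ih hA.1, count,
      Set.inter_union_distrib_left, Set.encard_union_eq]
    · rfl
    · exact (Set.disjoint_iUnion₂_right.2 fun j hj => hA.2 j hj).mono Set.inter_subset_right
        Set.inter_subset_right

/-- Removal of a point from a configuration. -/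
def erase (s : Config X) (x : X) : Config X :=
  ⟨s.1 \ {x}, fun K hK => (s.2 K hK).subset fun _ hy => ⟨hy.1.1, hy.2⟩⟩

lemma count_erase (s : Config X) (x : X) (A : Set X) :
    (s.erase x).count A = s.count (A \ {x}) := by
  rw [count, count, erase, Set.sdiff_inter_right_comm, Set.inter_sdiff_assoc]

lemma count_erase_of_mem (s : Config X) {x : X} {A : Set X} (hxs : x ∈ s.1) (hxA : x ∈ A) :
    (s.erase x).count A = s.count A - 1 := by
  rw [count_erase, count, ← Set.inter_sdiff_assoc]
  exact Set.encard_sdiff_singleton_of_mem ⟨hxs, hxA⟩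

lemma count_erase_of_notMem (s : Config X) {x : X} {A : Set X} (hxA : x ∉ A) :
    (s.erase x).count A = s.count A := by
  rw [count_erase, Set.sdiff_singleton_eq_self hxA]

lemma count_erase_counts_mem {J : Type*} [DecidableEq J] (s : Config X) {C : J → Set X}
    (hC : Pairwise (Function.onFun Disjoint C)) (j : J) (H : Set (J → ℕ∞)) :
    (s.count {x | x ∈ C j ∧ (fun i => (s.erase x).count (C i)) ∈ H} : ℝ≥0∞) =
      s.count (C j) * H.indicator 1
        (Function.update (fun i => s.count (C i)) j (s.count (C j) - 1)) := by
  have hupdate {x : X} (hxs : x ∈ s.1) (hx : x ∈ C j) : (fun i => (s.erase x).count (C i)) =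
      Function.update (fun i => s.count (C i)) j (s.count (C j) - 1) := by
    funext i
    rcases eq_or_ne i j with rfl | hij
    · rw [Function.update_self, s.count_erase_of_mem hxs hx]
    · rw [Function.update_of_ne hij, s.count_erase_of_notMem]
      exact Set.disjoint_right.1 (hC hij) hx
  by_cases hH : Function.update (fun i => s.count (C i)) j (s.count (C j) - 1) ∈ H
  · have hset : s.1 ∩ {x | x ∈ C j ∧ (fun i => (s.erase x).count (C i)) ∈ H} = s.1 ∩ C j := by
      ext x
      exact ⟨fun hx => ⟨hx.1, hx.2.1⟩, fun hx => ⟨hx.1, hx.2, hupdate hx.1 hx.2 ▸ hH⟩⟩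
    rw [Set.indicator_of_mem hH, Pi.one_apply, mul_one, count, hset, count]
  · have hset : s.1 ∩ {x | x ∈ C j ∧ (fun i => (s.erase x).count (C i)) ∈ H} = ∅ :=
      Set.eq_empty_of_forall_notMem fun x hx => hH (hupdate hx.1 hx.2.1 ▸ hx.2.2)
    rw [Set.indicator_of_notMem hH, mul_zero, count, hset]
    simp

section SigmaCompactSpace

variable [SigmaCompactSpace X]

lemma countable (s : Config X) : s.1.Countable := by
  rw [← Set.inter_univ s.1, ← iUnion_compactCovering X, Set.inter_iUnion]
  exact Set.countable_iUnion fun n => (s.2 _ (isCompact_compactCovering X n)).countable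

lemma measurableSet [MeasurableSpace X] [MeasurableSingletonClass X] (s : Config X) :
    MeasurableSet s.1 :=
  s.countable.measurableSet

end SigmaCompactSpace

variable [MeasurableSpace X]

lemma measurable_count {A : Set X} (hA : MeasurableSet A) :
    Measurable (count A : Config X → ℕ∞) :=
  (comap_measurable (count A)).mono (le_iSup₂_of_le A hA le_rfl) le_rfl

lemma measurable_of_measurable_count {Y : Type*} [MeasurableSpace Y] {f : Y → Config X}
    (hf : ∀ A, MeasurableSet A → Measurable fun y => (f y).count A) : Measurable f := by
  refine measurable_iff_comap_le.2 ?_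
  simp only [instMeasurableSpace, MeasurableSpace.comap_iSup, MeasurableSpace.comap_comp,
    iSup_le_iff]
  exact fun A hA => (hf A hA).comap_le

lemma measurable_counts {ι : Type*} {A : ι → Set X} (hA : ∀ i, MeasurableSet (A i)) :
    Measurable fun (s : Config X) i => s.count (A i) :=
  measurable_pi_lambda _ fun i => measurable_count (hA i)

section PointKernel

variable [SigmaCompactSpace X]

lemma count_restrict_apply [MeasurableSingletonClass X] (s : Config X) {A : Set X}
    (hA : MeasurableSet A) : Measure.count.restrict s.1 A = (s.count A : ℝ≥0∞) := by
  rw [Measure.restrict_apply hA, Measure.count_apply (hA.inter s.measurableSet), count,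
    Set.inter_comm]

variable (X) in
/-- The kernel from configurations to points which maps a configuration to the counting measure
of its points. -/
noncomputable def pointKernel [MeasurableSingletonClass X] : Kernel (Config X) X where
  toFun s := Measure.count.restrict s.1
  measurable' := by
    refine Measure.measurable_of_measurable_coe _ fun A hA => ?_
    simp_rw [count_restrict_apply _ hA]
    exact (measurable_of_countable _).comp (measurable_count hA)

lemma pointKernel_apply [MeasurableSingletonClass X] (s : Config X) {A : Set X}
    (hA : MeasurableSet A) : pointKernel X s A = (s.count A : ℝ≥0∞) :=
  count_restrict_apply s hA

variable [T2Space X] [OpensMeasurableSpace X]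

instance : IsSFiniteKernel (pointKernel X) := by
  let D : ℕ → Set X := disjointed (compactCovering X)
  have hD (n : ℕ) : MeasurableSet (D n) :=
    .disjointed (fun k => (isCompact_compactCovering X k).measurableSet) n
  have hfin (n : ℕ) (s : Config X) : IsFiniteMeasure ((pointKernel X).restrict (hD n) s) := by
    have hcount : s.count (D n) ≠ ⊤ :=
      ne_top_of_le_ne_top (s.count_ne_top_of_isCompact (isCompact_compactCovering X n))
        (s.count_mono (disjointed_subset _ n))
    refine ⟨?_⟩
    rw [Kernel.restrict_apply, Measure.restrict_apply_univ, pointKernel_apply _ (hD n)]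
    exact (ENat.toENNReal_ne_top.2 hcount).lt_top
  have hsum : pointKernel X = Kernel.sum fun n => (pointKernel X).restrict (hD n) := by
    ext1 s
    rw [Kernel.sum_apply]
    simp_rw [Kernel.restrict_apply]
    rw [← Measure.restrict_iUnion (disjoint_disjointed _) hD, iUnion_disjointed,
      iUnion_compactCovering, Measure.restrict_univ]
  have (n : ℕ) := isSFiniteKernel_of_forall_isFiniteMeasure ((pointKernel X).restrict (hD n))
  rw [hsum]
  exact Kernel.isSFiniteKernel_sum

lemma measurable_count_section {Y : Type*} [MeasurableSpace Y] {f : Y → Config X}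
    (hf : Measurable f) {W : Set (Y × X)} (hW : MeasurableSet W) :
    Measurable fun y => (f y).count (Prod.mk y ⁻¹' W) := by
  refine measurable_of_measurable_toENNReal ?_
  simp_rw [← pointKernel_apply _ (measurable_prodMk_left hW), ← Kernel.comap_apply _ hf]
  exact Kernel.measurable_kernel_prodMk_left hW

lemma measurable_erase [SecondCountableTopology X] :
    Measurable fun p : Config X × X => p.1.erase p.2 := by
  refine measurable_of_measurable_count fun A hA => ?_
  have hW : MeasurableSet {q : (Config X × X) × X | q.2 ∈ A ∧ q.2 ≠ q.1.2} :=
    (measurable_snd hA).inter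
      (measurableSet_eq_fun measurable_snd (measurable_snd.comp measurable_fst)).compl
  simp_rw [count_erase]
  exact measurable_count_section measurable_fst hW

lemma measurable_of_measurable_count_of_ne_top (μ : Measure X) [SigmaFinite μ] {Y : Type*}
    [MeasurableSpace Y] {f : Y → Config X}
    (hf : ∀ B, MeasurableSet B → μ B ≠ ∞ → Measurable fun y => (f y).count B) :
    Measurable f := by
  refine measurable_of_measurable_count fun A hA => measurable_of_measurable_toENNReal ?_
  have hAn (n : ℕ) : MeasurableSet (A ∩ spanningSets μ n) :=
    hA.inter (measurableSet_spanningSets μ n)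
  have hsup (y : Y) : ((f y).count A : ℝ≥0∞) =
      ⨆ n, ((f y).count (A ∩ spanningSets μ n) : ℝ≥0∞) := by
    simp_rw [← pointKernel_apply _ hA, ← pointKernel_apply _ (hAn _)]
    rw [← Monotone.measure_iUnion fun i j hij =>
      Set.inter_subset_inter_right A (monotone_spanningSets μ hij), ← Set.inter_iUnion,
      iUnion_spanningSets, Set.inter_univ]
  simp_rw [hsup]
  exact Measurable.iSup fun n => (measurable_of_countable _).comp <| hf _ (hAn n)
    (measure_inter_lt_top_of_right_ne_top (measure_spanningSets_lt_top μ n).ne).ne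

lemma ext_of_map_count (μ : Measure X) [SigmaFinite μ] {L₁ L₂ : Measure (Config X)}
    [IsFiniteMeasure L₁]
    (h : ∀ I : Finset {B : Set X // MeasurableSet B ∧ μ B ≠ ∞},
      L₁.map (fun s (B : I) => s.count B.1.1) = L₂.map (fun s (B : I) => s.count B.1.1)) :
    L₁ = L₂ := by
  let counts (s : Config X) (B : {B : Set X // MeasurableSet B ∧ μ B ≠ ∞}) : ℕ∞ := s.count B.1
  have hcounts : Measurable counts := measurable_counts fun B => B.2.1
  have hgen : Measurable[MeasurableSpace.comap counts inferInstance] (id : Config X → Config X) :=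
    letI := MeasurableSpace.comap counts inferInstance
    measurable_of_measurable_count_of_ne_top (Y := Config X) μ fun B hB hμB =>
      (measurable_pi_apply (⟨B, hB, hμB⟩ : {B : Set X // MeasurableSet B ∧ μ B ≠ ∞})).comp
        (comap_measurable counts)
  have hmap : L₁.map counts = L₂.map counts := by
    refine IsProjectiveLimit.unique (P := fun I => L₁.map (fun s (B : I) => s.count B.1.1))
      (fun I => ?_) (fun I => ?_)
    · rw [Measure.map_map (Finset.measurable_restrict I) hcounts]; rfl
    · rw [Measure.map_map (Finset.measurable_restrict I) hcounts]; exact (h I).symm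
  ext E hE
  obtain ⟨F, hF, hFE⟩ := hgen hE
  rw [Set.preimage_id] at hFE
  rw [← hFE, ← Measure.map_apply hcounts hF, hmap, Measure.map_apply hcounts hF]

lemma ext_of_map_count_of_disjoint (μ : Measure X) [SigmaFinite μ] {L₁ L₂ : Measure (Config X)}
    [IsFiniteMeasure L₁] {A : Set X} (hA : MeasurableSet A) (hμA : μ A ≠ ∞)
    (h : ∀ (n : ℕ) (C : Fin n → Set X), (∀ j, MeasurableSet (C j)) →
      Pairwise (Function.onFun Disjoint C) → (∀ j, μ (C j) ≠ ∞) →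
      (∃ T : Finset (Fin n), A = ⋃ j ∈ T, C j) →
      L₁.map (fun s j => s.count (C j)) = L₂.map (fun s j => s.count (C j))) :
    L₁ = L₂ := by
  refine ext_of_map_count μ fun I => ?_
  let B (o : Option I) : Set X := o.elim A fun b => b.1.1
  have hB (o : Option I) : MeasurableSet (B o) ∧ μ (B o) ≠ ∞ :=
    match o with
    | none => ⟨hA, hμA⟩
    | some b => b.1.2
  obtain ⟨n, C, hC, hdisj, hsub, hunion⟩ := exists_disjoint_refinement fun o => (hB o).1
  have hμC (j : Fin n) : μ (C j) ≠ ∞ :=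
    let ⟨o, ho⟩ := hsub j
    ne_top_of_le_ne_top (hB o).2 (measure_mono ho)
  choose T hT using hunion
  let add (k : Fin n → ℕ∞) (b : I) : ℕ∞ := ∑ j ∈ T (some b), k j
  have hadd : (fun (s : Config X) (b : I) => s.count b.1.1) =
      add ∘ fun s j => s.count (C j) := by
    funext s b
    exact (congrArg (s.count ·) (hT (some b))).trans
      (s.count_biUnion_finset fun i _ j _ hij => hdisj hij)
  rw [hadd, ← Measure.map_map (measurable_of_countable _) (measurable_counts hC),
    h n C hC hdisj hμC ⟨T none, hT none⟩,
    Measure.map_map (measurable_of_countable _) (measurable_counts hC)]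

end PointKernel

end Config

/-- The Poisson distribution, as a law on the extended natural numbers. -/
noncomputable def poissonENat (r : NNReal) : Measure ℕ∞ :=
  (poissonMeasure r).map fun k : ℕ => (k : ℕ∞)

instance (r : NNReal) : IsProbabilityMeasure (poissonENat r) :=
  Measure.isProbabilityMeasure_map (measurable_of_countable _).aemeasurable

lemma poissonENat_singleton_zero (r : NNReal) :
    poissonENat r {0} = ENNReal.ofReal (Real.exp (-r)) := by
  have hpre : (fun k : ℕ => (k : ℕ∞)) ⁻¹' {0} = {0} := by ext; simp
  rw [poissonENat, Measure.map_apply (measurable_of_countable _) (measurableSet_singleton _),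
    hpre, poissonMeasure_singleton]
  simp

lemma succ_mul_poissonMeasure_succ (r : NNReal) (k : ℕ) :
    ((k + 1 : ℕ) : ℝ≥0∞) * poissonMeasure r {k + 1} = r * poissonMeasure r {k} := by
  rw [poissonMeasure_singleton, poissonMeasure_singleton, ← ENNReal.ofReal_natCast,
    ← ENNReal.ofReal_coe_nnreal, ← ENNReal.ofReal_mul (by positivity),
    ← ENNReal.ofReal_mul (by positivity), Nat.factorial_succ]
  congr 1
  push_cast
  field_simp
  ring

lemma lintegral_mul_pred_poissonENat (r : NNReal) (F : ℕ∞ → ℝ≥0∞) :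
    ∫⁻ k, (k : ℝ≥0∞) * F (k - 1) ∂poissonENat r = r * ∫⁻ k, F k ∂poissonENat r := by
  have hsum (G : ℕ∞ → ℝ≥0∞) : ∫⁻ k, G k ∂poissonENat r = ∑' k : ℕ, G k * poissonMeasure r {k} := by
    rw [poissonENat, lintegral_map (measurable_of_countable _) (measurable_of_countable _),
      lintegral_countable']
  rw [hsum, hsum, tsum_eq_zero_add' ENNReal.summable, ← ENNReal.tsum_mul_left]
  simp only [Nat.cast_zero, ENat.toENNReal_zero, zero_mul, zero_add]
  refine tsum_congr fun k => ?_
  have hpred : ((k + 1 : ℕ) : ℕ∞) - 1 = k := by exact_mod_cast Nat.add_sub_cancel k 1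
  rw [hpred, ENat.toENNReal_coe, mul_right_comm, succ_mul_poissonMeasure_succ]
  ring

lemma lintegral_pi_poissonENat_mul_pred {J : Type*} [Fintype J] [DecidableEq J] (r : J → NNReal)
    (j : J) (F : (J → ℕ∞) → ℝ≥0∞) :
    ∫⁻ k, (k j : ℝ≥0∞) * F (Function.update k j (k j - 1))
        ∂Measure.pi (fun i => poissonENat (r i)) =
      r j * ∫⁻ k, F k ∂Measure.pi (fun i => poissonENat (r i)) := by
  rw [← lintegral_const_mul _ (measurable_of_countable _)]
  refine lintegral_eq_of_lmarginal_eq {j} (measurable_of_countable _) (measurable_of_countable _) ?_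
  funext k
  simp only [lmarginal_singleton, Function.update_self, Function.update_idem]
  rw [lintegral_const_mul _ (measurable_of_countable _)]
  exact lintegral_mul_pred_poissonENat (r j) fun i => F (Function.update k j i)

section ReducedCampbell

variable {X : Type*} [TopologicalSpace X] [MeasurableSpace X] [SigmaCompactSpace X] [T2Space X]
  [OpensMeasurableSpace X]

/-- The reduced Campbell measure of the law `L` of a point process: the image of the counting
measure of the points `x` of a configuration `s` of law `L` under `x ↦ (x, s \ {x})`. -/
noncomputable def reducedCampbell (L : Measure (Config X)) : Measure (X × Config X) :=
  (L ⊗ₘ Config.pointKernel X).map fun p => (p.2, p.1.erase p.2)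

variable [SecondCountableTopology X]

lemma reducedCampbell_apply (L : Measure (Config X)) [SFinite L] {W : Set (X × Config X)}
    (hW : MeasurableSet W) :
    reducedCampbell L W = ∫⁻ s, (s.count {x | (x, s.erase x) ∈ W} : ℝ≥0∞) ∂L := by
  have hmeas : Measurable fun p : Config X × X => (p.2, p.1.erase p.2) :=
    measurable_snd.prodMk Config.measurable_erase
  rw [reducedCampbell, Measure.map_apply hmeas hW, Measure.compProd_apply (hmeas hW)]
  exact lintegral_congr fun s => Config.pointKernel_apply s (measurable_prodMk_left (hmeas hW))

end ReducedCampbell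

namespace IsPoissonPointProcess

variable {Ω X : Type*} [MeasurableSpace Ω] [TopologicalSpace X] [MeasurableSpace X]
  {P : Measure Ω} {μ : Measure X} {Φ : Ω → Config X}

lemma measurable_count (hΦ : IsPoissonPointProcess P μ Φ) {A : Set X} (hA : MeasurableSet A) :
    Measurable fun ω => (Φ ω).count A :=
  (Config.measurable_count hA).comp hΦ.measurable

lemma measure_count_eq_zero (hΦ : IsPoissonPointProcess P μ Φ) {A : Set X} (hA : MeasurableSet A)
    (hμA : μ A ≠ ∞) :
    P {ω | (Φ ω).count A = 0} = ENNReal.ofReal (Real.exp (-(μ A).toReal)) := by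
  have hlaw := congrArg (fun L => L {0}) (hΦ.poisson A hA hμA)
  exact (Measure.map_apply (hΦ.measurable_count hA) (measurableSet_singleton _)).symm.trans
    (hlaw.trans (poissonENat_singleton_zero _))

lemma ae_count_ne_top (hΦ : IsPoissonPointProcess P μ Φ) {A : Set X} (hA : MeasurableSet A)
    (hμA : μ A ≠ ∞) : ∀ᵐ ω ∂P, (Φ ω).count A ≠ ⊤ := by
  have hlaw : ∀ᵐ k ∂P.map (fun ω => (Φ ω).count A), k ≠ ⊤ := by
    rw [hΦ.poisson A hA hμA, ae_map_iff (measurable_of_countable _).aemeasurable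
      (Set.to_countable _).measurableSet]
    exact .of_forall ENat.natCast_ne_top
  exact ae_of_ae_map (hΦ.measurable_count hA).aemeasurable hlaw

variable [IsProbabilityMeasure P]

lemma map_map_count (hΦ : IsPoissonPointProcess P μ Φ) {n : ℕ} {C : Fin n → Set X}
    (hC : ∀ j, MeasurableSet (C j)) (hdisj : Pairwise (Function.onFun Disjoint C))
    (hfin : ∀ j, μ (C j) ≠ ∞) :
    (P.map Φ).map (fun s j => s.count (C j)) =
      Measure.pi fun j => poissonENat (μ (C j)).toNNReal := by
  rw [Measure.map_map (Config.measurable_counts hC) hΦ.measurable]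
  refine ((iIndepFun_iff_map_fun_eq_pi_map fun j => (hΦ.measurable_count (hC j)).aemeasurable).1
    (hΦ.indep n C hC hdisj)).trans ?_
  congr 1
  exact funext fun j => hΦ.poisson _ (hC j) (hfin j)

variable [SigmaCompactSpace X] [T2Space X] [OpensMeasurableSpace X]

lemma reducedCampbell_prod_counts [SecondCountableTopology X]
    (hΦ : IsPoissonPointProcess P μ Φ) {n : ℕ} {C : Fin n → Set X}
    (hC : ∀ j, MeasurableSet (C j)) (hdisj : Pairwise (Function.onFun Disjoint C))
    (hfin : ∀ j, μ (C j) ≠ ∞) (j : Fin n) (H : Set (Fin n → ℕ∞)) :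
    reducedCampbell (P.map Φ) (C j ×ˢ ((fun s j => s.count (C j)) ⁻¹' H)) =
      μ (C j) * P.map Φ ((fun s j => s.count (C j)) ⁻¹' H) := by
  let counts (s : Config X) (j : Fin n) : ℕ∞ := s.count (C j)
  have hcounts : Measurable counts := Config.measurable_counts hC
  let F : (Fin n → ℕ∞) → ℝ≥0∞ := H.indicator 1
  calc reducedCampbell (P.map Φ) (C j ×ˢ (counts ⁻¹' H))
      = ∫⁻ s, (counts s j : ℝ≥0∞) * F (Function.update (counts s) j (counts s j - 1))
          ∂P.map Φ := by
        rw [reducedCampbell_apply _ ((hC j).prod (hcounts (Set.to_countable H).measurableSet))]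
        exact lintegral_congr fun s => s.count_erase_counts_mem hdisj j H
    _ = μ (C j) * ∫⁻ s, F (counts s) ∂P.map Φ := by
        rw [← lintegral_map (f := F) (measurable_of_countable _) hcounts,
          ← lintegral_map (f := fun k => (k j : ℝ≥0∞) * F (Function.update k j (k j - 1)))
            (measurable_of_countable _) hcounts, hΦ.map_map_count hC hdisj hfin,
          lintegral_pi_poissonENat_mul_pred, ENNReal.coe_toNNReal (hfin j)]
    _ = μ (C j) * P.map Φ (counts ⁻¹' H) := by
        rw [← lintegral_indicator_one (hcounts (Set.to_countable H).measurableSet)]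
        rfl

variable [SigmaFinite μ]

lemma map_eq_map (hΦ : IsPoissonPointProcess P μ Φ) {Ω' : Type*} [MeasurableSpace Ω']
    {P' : Measure Ω'} [IsProbabilityMeasure P'] {Φ' : Ω' → Config X}
    (hΦ' : IsPoissonPointProcess P' μ Φ') : P.map Φ = P'.map Φ' :=
  Config.ext_of_map_count_of_disjoint μ .empty (by simp) fun _ _ hC hdisj hfin _ =>
    (hΦ.map_map_count hC hdisj hfin).trans (hΦ'.map_map_count hC hdisj hfin).symm

variable [SecondCountableTopology X]

/-- On a product of a union of cells of a finite partition with an event that depends on the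
counts of the cells only, the Mecke equation is the size-bias identity for Poisson laws. -/
lemma reducedCampbell_prod (hΦ : IsPoissonPointProcess P μ Φ) {A : Set X} (hA : MeasurableSet A)
    (hμA : μ A ≠ ∞) {E : Set (Config X)} (hE : MeasurableSet E) :
    reducedCampbell (P.map Φ) (A ×ˢ E) = μ A * P.map Φ E := by
  have : IsFiniteMeasure (μ A • P.map Φ) := ⟨by
    simpa using ENNReal.mul_lt_top hμA.lt_top (measure_lt_top (P.map Φ) _)⟩
  suffices hsnd : μ A • P.map Φ =
      ((reducedCampbell (P.map Φ)).restrict (A ×ˢ Set.univ)).map Prod.snd by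
    have hE' := congrArg (fun L => L E) hsnd
    rw [Measure.map_apply measurable_snd hE, Measure.restrict_apply (measurable_snd hE)] at hE'
    rw [← smul_eq_mul, ← Measure.smul_apply, hE']
    congr 1
    ext; simp [and_comm]
  refine Config.ext_of_map_count_of_disjoint μ hA hμA fun n C hC hdisj hfin ⟨T, hT⟩ => ?_
  ext H hH
  have hcounts := Config.measurable_counts hC
  have hpre : Prod.snd ⁻¹' ((fun (s : Config X) j => s.count (C j)) ⁻¹' H) ∩ A ×ˢ Set.univ =
      ⋃ j ∈ T, C j ×ˢ ((fun (s : Config X) j => s.count (C j)) ⁻¹' H) := by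
    rw [← Set.iUnion₂_prod_const, ← hT, Set.prod_univ, Set.inter_comm, ← Set.prod_eq]
  rw [Measure.map_apply hcounts hH, Measure.map_apply hcounts hH,
    Measure.map_apply measurable_snd (hcounts hH),
    Measure.restrict_apply (measurable_snd (hcounts hH)), hpre, measure_biUnion_finset
      (fun i _ j _ hij => Set.disjoint_prod.2 (.inl (hdisj hij)))
      (fun j _ => (hC j).prod (hcounts hH)), Measure.smul_apply, smul_eq_mul, hT,
    measure_biUnion_finset (fun i _ j _ hij => hdisj hij) (fun j _ => hC j), Finset.sum_mul]
  exact Finset.sum_congr rfl fun j _ => (hΦ.reducedCampbell_prod_counts hC hdisj hfin j H).symm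

theorem mecke (hΦ : IsPoissonPointProcess P μ Φ) :
    reducedCampbell (P.map Φ) = μ.prod (P.map Φ) := by
  refine (Measure.prod_eq fun A E hA hE => ?_).symm
  have hmono : Monotone fun n => (A ∩ spanningSets μ n) ×ˢ E := fun i j hij =>
    Set.prod_mono (Set.inter_subset_inter_right A (monotone_spanningSets μ hij)) subset_rfl
  calc reducedCampbell (P.map Φ) (A ×ˢ E)
      = ⨆ n, reducedCampbell (P.map Φ) ((A ∩ spanningSets μ n) ×ˢ E) := by
        rw [← hmono.measure_iUnion, ← Set.iUnion_prod_const, ← Set.inter_iUnion,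
          iUnion_spanningSets, Set.inter_univ]
    _ = ⨆ n, μ.restrict (spanningSets μ n) A * P.map Φ E := by
        refine iSup_congr fun n => ?_
        rw [Measure.restrict_apply hA]
        exact hΦ.reducedCampbell_prod (hA.inter (measurableSet_spanningSets μ n))
          (measure_inter_lt_top_of_right_ne_top (measure_spanningSets_lt_top μ n).ne).ne hE
    _ = μ A * P.map Φ E := by
        rw [← ENNReal.iSup_mul, Measure.iSup_restrict_spanningSets]

end IsPoissonPointProcess

section MarkMeasure

variable {ξ : ℝ}

instance : LocallyCompactSpace Mark := isOpen_Ioi.locallyCompactSpace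

instance : SigmaFinite ((volume : Measure ℝ).comap ((↑) : Mark → ℝ)) := by
  refine SigmaFinite.of_map _ (f := ((↑) : Mark → ℝ)) (by fun_prop) ?_
  rw [map_comap_subtype_coe measurableSet_Ioi]
  infer_instance

instance (ξ : ℝ) : SigmaFinite (Gξ ξ) := SigmaFinite.withDensity_ofReal _

instance (ξ : ℝ) : NullSingletonClass (Gξ ξ) where
  measure_singleton m := by
    refine withDensity_absolutelyContinuous _ _ ?_
    rw [(MeasurableEmbedding.subtype_coe measurableSet_Ioi).comap_apply]
    simp

lemma image_rpow_neg_Ioi (hξ : 0 < ξ) : (fun x : ℝ => x ^ (-ξ)) '' Set.Ioi 0 = Set.Ioi 0 := by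
  refine Set.Subset.antisymm ?_ fun t ht => ⟨t ^ (-ξ)⁻¹, Real.rpow_pos_of_pos ht _,
    Real.rpow_inv_rpow (le_of_lt ht) (neg_ne_zero.2 hξ.ne')⟩
  rintro _ ⟨x, hx, rfl⟩
  exact Real.rpow_pos_of_pos hx _

lemma measurePreserving_rpow_neg_Gξ (hξ : 0 < ξ) :
    MeasurePreserving (fun m : Mark => (m : ℝ) ^ (-ξ)) (Gξ ξ) (volume.restrict (Set.Ioi 0)) := by
  have hmeas : Measurable fun m : Mark => (m : ℝ) ^ (-ξ) := by fun_prop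
  have hinj : Set.InjOn (fun x : ℝ => x ^ (-ξ)) (Set.Ioi 0) :=
    (Real.rpow_left_injOn (neg_ne_zero.2 hξ.ne')).mono Set.Ioi_subset_Ici_self
  refine ⟨hmeas, Measure.ext_of_lintegral _ fun f hf => ?_⟩
  have hderiv (x : ℝ) (hx : x ∈ Set.Ioi 0) :=
    (Real.hasDerivAt_rpow_const (p := -ξ) (.inl (ne_of_gt hx))).hasDerivWithinAt (s := Set.Ioi 0)
  have hsubst := lintegral_image_eq_lintegral_abs_deriv_mul measurableSet_Ioi hderiv hinj f
  rw [image_rpow_neg_Ioi hξ] at hsubst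
  rw [lintegral_map hf hmeas, hsubst, ← lintegral_subtype_comap measurableSet_Ioi, Gξ,
    lintegral_withDensity_eq_lintegral_mul _ (by fun_prop) (by fun_prop)]
  refine lintegral_congr fun m => ?_
  rw [Pi.mul_apply, abs_mul, abs_neg, abs_of_pos hξ, abs_of_pos (Real.rpow_pos_of_pos m.2 _)]

lemma Gξ_univ (hξ : 0 < ξ) : Gξ ξ Set.univ = ∞ := by
  simpa using (measurePreserving_rpow_neg_Gξ hξ).measure_preimage
    MeasurableSet.univ.nullMeasurableSet

lemma volume_restrict_Ioi_ofReal_lt (r : ℝ≥0∞) :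
    (volume : Measure ℝ).restrict (Set.Ioi 0) {s | ENNReal.ofReal s < r} = r := by
  rcases eq_or_ne r ∞ with rfl | hr
  · simp
  · have hset : {s : ℝ | ENNReal.ofReal s < r} ∩ Set.Ioi 0 = Set.Ioo 0 r.toReal := by
      ext s
      exact and_comm.trans (and_congr_right fun hs => ENNReal.ofReal_lt_iff_lt_toReal hs.le hr)
    rw [Measure.restrict_apply (measurableSet_lt (by fun_prop) measurable_const), hset,
      Real.volume_Ioo, sub_zero, ENNReal.ofReal_toReal hr]

lemma Gξ_lt_mul (hξ : 0 < ξ) (t H : ℝ≥0∞) :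
    Gξ ξ {m | t < ENNReal.ofReal m * H} = (H / t) ^ ξ := by
  have hset : {m : Mark | t < ENNReal.ofReal m * H} =
      (fun m : Mark => (m : ℝ) ^ (-ξ)) ⁻¹' {s | ENNReal.ofReal s < (H / t) ^ ξ} := by
    ext m
    have hm : (0 : ℝ) < m := m.2
    have hm₀ : ENNReal.ofReal (m : ℝ) ≠ 0 := (ENNReal.ofReal_pos.2 hm).ne'
    have hpow : ENNReal.ofReal ((m : ℝ) ^ (-ξ)) = (ENNReal.ofReal m)⁻¹ ^ ξ := by
      rw [← ENNReal.ofReal_rpow_of_pos hm, ENNReal.rpow_neg, ENNReal.inv_rpow]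
    rw [Set.mem_preimage, Set.mem_ofPred_eq, Set.mem_ofPred_eq, hpow,
      ENNReal.rpow_lt_rpow_iff hξ,
      ENNReal.lt_div_iff_mul_lt (.inr (ENNReal.inv_ne_top.2 hm₀))
        (.inr (ENNReal.inv_ne_zero.2 ENNReal.ofReal_ne_top)), mul_comm _ t, ← div_eq_mul_inv,
      ENNReal.div_lt_iff (.inl hm₀) (.inl ENNReal.ofReal_ne_top), mul_comm]
  rw [hset, (measurePreserving_rpow_neg_Gξ hξ).measure_preimage
    (measurableSet_lt (by fun_prop) measurable_const).nullMeasurableSet,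
    volume_restrict_Ioi_ofReal_lt]

lemma lintegral_exp_neg_mul_rpow_neg_Gξ (hξ : 0 < ξ) {a : ℝ} (ha : 0 < a) :
    ∫⁻ m : Mark, ENNReal.ofReal (Real.exp (-(a * (m : ℝ) ^ (-ξ)))) ∂Gξ ξ =
      (ENNReal.ofReal a)⁻¹ := by
  rw [(measurePreserving_rpow_neg_Gξ hξ).lintegral_comp
    (f := fun t => ENNReal.ofReal (Real.exp (-(a * t)))) (by fun_prop)]
  simp only [← neg_mul]
  rw [← ofReal_integral_eq_lintegral_ofReal (integrableOn_exp_mul_Ioi (neg_neg_of_pos ha) 0)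
    (ae_of_all _ fun t => (Real.exp_pos _).le), integral_exp_mul_Ioi (neg_neg_of_pos ha),
    ← ENNReal.ofReal_inv_of_pos ha]
  simp

end MarkMeasure

section ShotNoise

variable {d : ℕ} {h : Loc d → ℝ≥0∞}

lemma Config.count_translate (z : Loc d) (s : Config (Loc d × Mark)) (A : Set (Loc d × Mark)) :
    (s.translate z).count A = s.count ((fun φ : Loc d × Mark => (φ.1 + z, φ.2)) ⁻¹' A) := by
  have hinj : Function.Injective fun φ : Loc d × Mark => (φ.1 + z, φ.2) :=
    (add_left_injective z).prodMap Function.injective_id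
  rw [count, count, ← hinj.encard_image (s.1 ∩ _), Set.image_inter_preimage]
  rfl

lemma Config.measurable_translate (z : Loc d) :
    Measurable (translate z : Config (Loc d × Mark) → Config (Loc d × Mark)) := by
  refine measurable_of_measurable_count fun A hA => ?_
  simp_rw [count_translate]
  exact measurable_count ((by fun_prop : Measurable fun φ : Loc d × Mark => (φ.1 + z, φ.2)) hA)

lemma measurable_shot (hh : Measurable h) :
    Measurable fun p : (Loc d × Mark) × Loc d => shot h p.1 p.2 := by
  unfold shot
  fun_prop

lemma continuous_shot (hh : Continuous h) (φ : Loc d × Mark) : Continuous (shot h φ) :=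
  (ENNReal.continuous_const_mul ENNReal.ofReal_ne_top).comp (by fun_prop)

lemma continuous_shot_left (hh : Continuous h) (y : Loc d) :
    Continuous fun φ : Loc d × Mark => shot h φ y := by
  refine continuous_iff_continuousAt.2 fun φ => ?_
  have hmark : Continuous fun φ : Loc d × Mark => ENNReal.ofReal (φ.2 : ℝ) :=
    ENNReal.continuous_ofReal.comp (by fun_prop)
  have hloc : Continuous fun φ : Loc d × Mark => h (y - φ.1) := by fun_prop
  exact ENNReal.Tendsto.mul hmark.continuousAt (.inl (ENNReal.ofReal_pos.2 φ.2.2).ne')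
    hloc.continuousAt (.inr ENNReal.ofReal_ne_top)

lemma shot_translate (φ : Loc d × Mark) (z y : Loc d) :
    shot h (φ.1 + z, φ.2) y = shot h φ (y - z) := by
  rw [shot, shot, sub_add_eq_sub_sub_swap]

lemma shot_le_shotNoise {s : Config (Loc d × Mark)} {φ : Loc d × Mark} (hφ : φ ∈ s.1)
    (y : Loc d) : shot h φ y ≤ shotNoise h s y :=
  le_iSup₂_of_le φ hφ le_rfl

lemma shotNoise_le_shotNoise {g : Loc d → ℝ≥0∞} {y y' : Loc d}
    (hgh : ∀ x, g (y - x) ≤ h (y' - x)) (s : Config (Loc d × Mark)) :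
    shotNoise g s y ≤ shotNoise h s y' :=
  iSup₂_mono fun φ _ => mul_le_mul_right (hgh φ.1) _

lemma shotNoise_le_iff_count_eq_zero {s : Config (Loc d × Mark)} {y : Loc d} {t : ℝ≥0∞} :
    shotNoise h s y ≤ t ↔ s.count {φ | t < shot h φ y} = 0 := by
  rw [shotNoise, iSup₂_le_iff, Config.count, Set.encard_eq_zero, ← Set.disjoint_iff_inter_eq_empty,
    Set.disjoint_left]
  exact forall₂_congr fun φ _ => not_lt.symm

lemma measurable_shotNoise (hh : Measurable h) :
    Measurable fun p : Config (Loc d × Mark) × Loc d => shotNoise h p.1 p.2 := by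
  refine measurable_of_Iic fun t => ?_
  have hW : MeasurableSet
      {q : (Config (Loc d × Mark) × Loc d) × (Loc d × Mark) | t < shot h q.2 q.1.2} :=
    measurableSet_lt measurable_const ((measurable_shot hh).comp
      (measurable_snd.prodMk (measurable_snd.comp measurable_fst)))
  simp only [Set.preimage, Set.mem_Iic, shotNoise_le_iff_count_eq_zero]
  exact Config.measurable_count_section measurable_fst hW (measurableSet_singleton 0)

lemma shotNoise_translate (z : Loc d) (s : Config (Loc d × Mark)) (y : Loc d) :
    shotNoise h (s.translate z) y = shotNoise h s (y - z) := by
  simp only [shotNoise, Config.translate, iSup_image, shot_translate]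

lemma extremal_translate (z : Loc d) (s : Config (Loc d × Mark)) :
    extremal h (s.translate z) = (extremal h s).translate z := by
  have hattain (φ : Loc d × Mark) : (∃ y, shotNoise h (s.translate z) y =
      shot h (φ.1 + z, φ.2) y) ↔ ∃ y, shotNoise h s y = shot h φ y := by
    simp only [shotNoise_translate, shot_translate]
    exact (Equiv.subRight z).exists_congr_left.trans (by simp)
  refine Subtype.ext (Set.ext fun ψ => ⟨?_, ?_⟩)
  · rintro ⟨⟨φ, hφ, rfl⟩, hψ⟩
    exact ⟨φ, ⟨hφ, (hattain φ).1 hψ⟩, rfl⟩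
  · rintro ⟨φ, ⟨hφ, hψ⟩, rfl⟩
    exact ⟨⟨φ, hφ, rfl⟩, (hattain φ).2 hψ⟩

lemma shotNoise_erase_le_iff {s : Config (Loc d × Mark)} (φ : Loc d × Mark) (y : Loc d) :
    shotNoise h (s.erase φ) y ≤ shot h φ y ↔ shotNoise h s y ≤ shot h φ y := by
  simp only [shotNoise, iSup₂_le_iff]
  refine ⟨fun H ψ hψ => ?_, fun H ψ hψ => H ψ hψ.1⟩
  rcases eq_or_ne ψ φ with rfl | hψφ
  · exact le_rfl
  · exact H ψ ⟨hψ, hψφ⟩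

lemma mem_extremal_iff {s : Config (Loc d × Mark)} {φ : Loc d × Mark} (hφ : φ ∈ s.1) :
    φ ∈ (extremal h s).1 ↔ ∃ y, shotNoise h (s.erase φ) y ≤ shot h φ y := by
  simp only [shotNoise_erase_le_iff]
  exact (and_iff_right hφ).trans
    (exists_congr fun y => ⟨fun hy => hy.le, fun hy => hy.antisymm (shot_le_shotNoise hφ y)⟩)

/-- The marked points whose function exceeds the level `1 / j` somewhere on the closed ball of
radius `n` about the origin; for `j = 0` the level is `∞`. -/
def highShots (h : Loc d → ℝ≥0∞) (n j : ℕ) : Set (Loc d × Mark) :=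
  {φ | ∃ y ∈ Metric.closedBall (0 : Loc d) n, (j : ℝ≥0∞)⁻¹ < shot h φ y}

lemma measurableSet_highShots (hh : Continuous h) (n j : ℕ) : MeasurableSet (highShots h n j) := by
  have hunion : highShots h n j =
      ⋃ y ∈ Metric.closedBall (0 : Loc d) n, {φ | (j : ℝ≥0∞)⁻¹ < shot h φ y} := by
    ext φ; simp [highShots]
  rw [hunion]
  exact (isOpen_biUnion fun y _ =>
    isOpen_lt continuous_const (continuous_shot_left hh y)).measurableSet

/-- A configuration is tame for `h` if on each bounded set only finitely many of the functions of
its points exceed any given positive level. Its extremal shot noise is then locally a maximum of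
finitely many continuous functions, as long as it stays away from `0`. -/
def Tame (h : Loc d → ℝ≥0∞) (s : Config (Loc d × Mark)) : Prop :=
  ∀ n j : ℕ, s.count (highShots h n j) ≠ ⊤

lemma Tame.erase {s : Config (Loc d × Mark)} (hs : Tame h s) (φ : Loc d × Mark) :
    Tame h (s.erase φ) := fun n j =>
  ne_top_of_le_ne_top (hs n j) ((s.count_erase φ _).trans_le (s.count_mono Set.sdiff_subset))

lemma measurableSet_tame (hh : Continuous h) : MeasurableSet {s | Tame h s} := by
  simp only [Tame, Set.ofPred_forall]
  exact .iInter fun n => .iInter fun j =>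
    (Config.measurable_count (measurableSet_highShots hh n j) (measurableSet_singleton ⊤)).compl

lemma Tame.continuous_shotNoise (hh : Continuous h) {s : Config (Loc d × Mark)} (hs : Tame h s) :
    Continuous (shotNoise h s) := by
  refine continuous_iff_lower_upperSemicontinuous.2
    ⟨lowerSemicontinuous_biSup fun φ _ => (continuous_shot hh φ).lowerSemicontinuous,
      fun y c hc => ?_⟩
  obtain ⟨c', hyc', hc'⟩ := exists_between hc
  obtain ⟨j, hj⟩ := ENNReal.exists_inv_nat_lt hyc'.ne_bot
  obtain ⟨n, hn⟩ := exists_nat_gt ‖y‖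
  have hhigh : ∀ᶠ x in nhds y, ∀ φ ∈ s.1 ∩ highShots h n j, shot h φ x < c' :=
    (Set.encard_ne_top_iff.1 (hs n j)).eventually_all.2 fun φ hφ =>
      (continuous_shot hh φ).continuousAt.eventually_lt continuousAt_const
        ((shot_le_shotNoise hφ.1 y).trans_lt hyc')
  have hball : ∀ᶠ x in nhds y, x ∈ Metric.closedBall (0 : Loc d) n :=
    Metric.closedBall_mem_nhds_of_mem (by simpa using hn)
  filter_upwards [hhigh, hball] with x hx hxn
  refine (iSup₂_le fun φ hφ => ?_).trans_lt hc'
  by_cases hφ' : φ ∈ highShots h n j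
  · exact (hx φ ⟨hφ, hφ'⟩).le
  · exact le_of_not_gt fun hlt => hφ' ⟨x, hxn, hj.trans hlt⟩

/-- The pairs `(φ, s)` such that `s` is tame and the function of `φ` reaches the extremal shot
noise of `s` somewhere. -/
def touchSet (h : Loc d → ℝ≥0∞) : Set ((Loc d × Mark) × Config (Loc d × Mark)) :=
  {p | Tame h p.2 ∧ ∃ y, shotNoise h p.2 y ≤ shot h p.1 y}

/-- The pairs `(φ, s)` such that `s` is tame and the function of `φ` exceeds the extremal shot
noise of `s` somewhere. -/
def exceedSet (h : Loc d → ℝ≥0∞) : Set ((Loc d × Mark) × Config (Loc d × Mark)) :=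
  {p | Tame h p.2 ∧ ∃ y, shotNoise h p.2 y < shot h p.1 y}

lemma measurable_shotNoise_snd (hh : Continuous h) (y : Loc d) :
    Measurable fun p : (Loc d × Mark) × Config (Loc d × Mark) => shotNoise h p.2 y :=
  (measurable_shotNoise hh.measurable).comp (measurable_snd.prodMk measurable_const)

lemma measurable_shot_fst (hh : Continuous h) (y : Loc d) :
    Measurable fun p : (Loc d × Mark) × Config (Loc d × Mark) => shot h p.1 y :=
  (continuous_shot_left hh y).measurable.comp measurable_fst

lemma measurableSet_exceedSet (hh : Continuous h) : MeasurableSet (exceedSet h) := by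
  have hcountable : exceedSet h = Prod.snd ⁻¹' {s | Tame h s} ∩
      ⋃ i, {p | shotNoise h p.2 (TopologicalSpace.denseSeq (Loc d) i) <
        shot h p.1 (TopologicalSpace.denseSeq (Loc d) i)} := by
    ext p
    rw [← Set.ofPred_exists]
    exact and_congr_right fun hp =>
      exists_lt_iff_denseSeq (hp.continuous_shotNoise hh) (continuous_shot hh p.1)
  rw [hcountable]
  exact (measurable_snd (measurableSet_tame hh)).inter <| .iUnion fun i =>
    measurableSet_lt (measurable_shotNoise_snd hh _) (measurable_shot_fst hh _)

lemma measurableSet_touchSet (hh : Continuous h) (h_top : ∀ x, h x ≠ ∞) :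
    MeasurableSet (touchSet h) := by
  have hcountable : touchSet h = Prod.snd ⁻¹' {s | Tame h s} ∩
      ⋃ n : ℕ, ⋂ k : ℕ, ⋃ i, {p | TopologicalSpace.denseSeq (Loc d) i ∈ Metric.ball 0 n ∧
        shotNoise h p.2 (TopologicalSpace.denseSeq (Loc d) i) <
          shot h p.1 (TopologicalSpace.denseSeq (Loc d) i) + (k : ℝ≥0∞)⁻¹} := by
    ext p
    simp only [← Set.ofPred_exists, ← Set.ofPred_forall]
    exact and_congr_right fun hp =>
      exists_le_iff_denseSeq (hp.continuous_shotNoise hh) (continuous_shot hh p.1)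
        (fun y => ENNReal.mul_ne_top ENNReal.ofReal_ne_top (h_top _)) 0
  rw [hcountable]
  exact (measurable_snd (measurableSet_tame hh)).inter <|
    .iUnion fun n => .iInter fun k => .iUnion fun i => (MeasurableSet.const _).inter
      (measurableSet_lt (measurable_shotNoise_snd hh _) ((measurable_shot_fst hh _).add_const _))

lemma Tame.count_extremal {s : Config (Loc d × Mark)} (hs : Tame h s) (A : Set (Loc d × Mark)) :
    (extremal h s).count A = s.count {φ | (φ, s.erase φ) ∈ Prod.fst ⁻¹' A ∩ touchSet h} := by
  rw [Config.count, Config.count]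
  congr 1
  ext φ
  constructor
  · rintro ⟨hφ, hφA⟩
    exact ⟨hφ.1, hφA, hs.erase φ, (mem_extremal_iff hφ.1).1 hφ⟩
  · rintro ⟨hφ, hφA, -, htouch⟩
    exact ⟨(mem_extremal_iff hφ).2 htouch, hφA⟩

lemma aemeasurable_extremal (hh : Continuous h) (h_top : ∀ x, h x ≠ ∞)
    {L : Measure (Config (Loc d × Mark))} (hL : ∀ᵐ s ∂L, Tame h s) :
    AEMeasurable (extremal h) L := by
  rw [← Measure.restrict_eq_self_of_ae_mem hL]
  refine aemeasurable_restrict_of_measurable_subtype (measurableSet_tame hh)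
    (Config.measurable_of_measurable_count fun A hA => ?_)
  have hW : MeasurableSet {q : {s | Tame h s} × (Loc d × Mark) |
      (q.2, q.1.1.erase q.2) ∈ Prod.fst ⁻¹' A ∩ touchSet h} :=
    (measurable_snd.prodMk (Config.measurable_erase.comp
      ((measurable_subtype_coe.comp measurable_fst).prodMk measurable_snd)))
      ((measurable_fst hA).inter (measurableSet_touchSet hh h_top))
  have hcount : (fun s : {s | Tame h s} => (extremal h s.1).count A) =
      fun s => s.1.count (Prod.mk s ⁻¹' {q : {s | Tame h s} × (Loc d × Mark) |
        (q.2, q.1.1.erase q.2) ∈ Prod.fst ⁻¹' A ∩ touchSet h}) :=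
    funext fun s => s.2.count_extremal A
  exact hcount ▸ Config.measurable_count_section measurable_subtype_coe hW

end ShotNoise

section FrechetMarginals

/-- The intensity measure `dx G_ξ(dm)` of the Poisson point process. -/
noncomputable abbrev intensity (d : ℕ) (ξ : ℝ) : Measure (Loc d × Mark) := volume.prod (Gξ ξ)

variable {d : ℕ} {ξ : ℝ} {g : Loc d → ℝ≥0∞}

lemma measurableSet_lt_shot (hg : Measurable g) (t : ℝ≥0∞) (y : Loc d) :
    MeasurableSet {φ | t < shot g φ y} :=
  measurableSet_lt measurable_const
    ((measurable_shot hg).comp (measurable_id.prodMk measurable_const))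

lemma intensity_lt_shot (hξ : 0 < ξ) (hg : Measurable g) (t : ℝ≥0∞) (y : Loc d) :
    intensity d ξ {φ | t < shot g φ y} = (∫⁻ x, g x ^ ξ) / t ^ ξ := by
  have hsection (x : Loc d) :
      Gξ ξ (Prod.mk x ⁻¹' {φ | t < shot g φ y}) = g (y - x) ^ ξ * (t ^ ξ)⁻¹ := by
    rw [← div_eq_mul_inv, ← ENNReal.div_rpow_of_nonneg _ _ hξ.le]
    exact Gξ_lt_mul hξ t (g (y - x))
  rw [intensity, Measure.prod_apply (measurableSet_lt_shot hg t y), lintegral_congr hsection,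
    lintegral_mul_const _ (by fun_prop), lintegral_sub_left_eq_self (fun x => g x ^ ξ) y,
    div_eq_mul_inv]

namespace IsPoissonPointProcess

variable {Ω : Type*} [MeasurableSpace Ω] {P : Measure Ω} {Φ : Ω → Config (Loc d × Mark)}

lemma measure_shotNoise_le (hΦ : IsPoissonPointProcess P (intensity d ξ) Φ) (hξ : 0 < ξ)
    (hg : Measurable g) (hg_int : ∫⁻ x, g x ^ ξ ≠ ∞) {t : ℝ≥0∞} (ht : t ≠ 0) (y : Loc d) :
    P {ω | shotNoise g (Φ ω) y ≤ t} =
      ENNReal.ofReal (Real.exp (-((∫⁻ x, g x ^ ξ) / t ^ ξ).toReal)) := by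
  simp_rw [shotNoise_le_iff_count_eq_zero]
  rw [← intensity_lt_shot hξ hg t y]
  refine hΦ.measure_count_eq_zero (measurableSet_lt_shot hg t y) ?_
  rw [intensity_lt_shot hξ hg]
  exact ENNReal.div_ne_top hg_int (by simp [ENNReal.rpow_eq_zero_iff, ht, hξ.not_gt])

lemma lintegral_measure_shotNoise_le_mul (hΦ : IsPoissonPointProcess P (intensity d ξ) Φ)
    (hξ : 0 < ξ) (hg : Measurable g) (hg_pos : ∫⁻ x, g x ^ ξ ≠ 0) (hg_int : ∫⁻ x, g x ^ ξ ≠ ∞)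
    {H : ℝ≥0∞} (hH : H ≠ 0) (hH_top : H ≠ ∞) (y : Loc d) :
    ∫⁻ m : Mark, P {ω | shotNoise g (Φ ω) y ≤ ENNReal.ofReal m * H} ∂Gξ ξ =
      H ^ ξ / ∫⁻ x, g x ^ ξ := by
  have hHξ : H ^ ξ ≠ 0 := by simp [ENNReal.rpow_eq_zero_iff, hH, hξ.not_gt]
  have hHξ_top : H ^ ξ ≠ ∞ := ENNReal.rpow_ne_top_of_nonneg hξ.le hH_top
  have ha : (∫⁻ x, g x ^ ξ) / H ^ ξ ≠ 0 := ENNReal.div_ne_zero.2 ⟨hg_pos, hHξ_top⟩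
  have ha_top : (∫⁻ x, g x ^ ξ) / H ^ ξ ≠ ∞ := ENNReal.div_ne_top hg_int hHξ
  have hprob (m : Mark) : P {ω | shotNoise g (Φ ω) y ≤ ENNReal.ofReal m * H} =
      ENNReal.ofReal (Real.exp (-(((∫⁻ x, g x ^ ξ) / H ^ ξ).toReal * (m : ℝ) ^ (-ξ)))) := by
    have hm : (0 : ℝ) < m := m.2
    rw [hΦ.measure_shotNoise_le hξ hg hg_int (mul_ne_zero (ENNReal.ofReal_pos.2 hm).ne' hH),
      mul_comm, ENNReal.mul_rpow_of_nonneg _ _ hξ.le, div_eq_mul_inv,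
      ENNReal.mul_inv (.inl hHξ) (.inl hHξ_top), ← mul_assoc, ENNReal.toReal_mul, ← div_eq_mul_inv,
      ENNReal.toReal_inv, ← ENNReal.toReal_rpow, ENNReal.toReal_ofReal hm.le, Real.rpow_neg hm.le]
  simp_rw [hprob]
  rw [lintegral_exp_neg_mul_rpow_neg_Gξ hξ (ENNReal.toReal_pos ha ha_top),
    ENNReal.ofReal_toReal ha_top, ENNReal.inv_div (.inl hHξ_top) (.inl hHξ)]

lemma ae_shotNoise_pos_at (hΦ : IsPoissonPointProcess P (intensity d ξ) Φ) (hξ : 0 < ξ)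
    (hg : Measurable g) (hg_pos : ∫⁻ x, g x ^ ξ ≠ 0) (hg_int : ∫⁻ x, g x ^ ξ ≠ ∞) (y : Loc d) :
    ∀ᵐ ω ∂P, 0 < shotNoise g (Φ ω) y := by
  have hle : P {ω | shotNoise g (Φ ω) y ≤ 0} * ∞ ≤ (∫⁻ x, g x ^ ξ)⁻¹ := by
    calc P {ω | shotNoise g (Φ ω) y ≤ 0} * ∞
        = ∫⁻ _ : Mark, P {ω | shotNoise g (Φ ω) y ≤ 0} ∂Gξ ξ := by
          rw [lintegral_const, Gξ_univ hξ]
      _ ≤ ∫⁻ m : Mark, P {ω | shotNoise g (Φ ω) y ≤ ENNReal.ofReal m * 1} ∂Gξ ξ :=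
          lintegral_mono fun m => measure_mono (Set.ofPred_subset_ofPred.2 fun ω hω =>
            hω.trans zero_le)
      _ = (∫⁻ x, g x ^ ξ)⁻¹ := by
          rw [hΦ.lintegral_measure_shotNoise_le_mul hξ hg hg_pos hg_int one_ne_zero
            ENNReal.one_ne_top, ENNReal.one_rpow, one_div]
  have hzero : P {ω | shotNoise g (Φ ω) y ≤ 0} = 0 := by
    by_contra hne
    rw [ENNReal.mul_top hne, top_le_iff, ENNReal.inv_eq_top] at hle
    exact hg_pos hle
  simpa only [ae_iff, not_lt] using hzero

lemma lintegral_measure_shotNoise_le_mul_le (hΦ : IsPoissonPointProcess P (intensity d ξ) Φ)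
    (hξ : 0 < ξ) (hg : Measurable g) (hg_pos : ∫⁻ x, g x ^ ξ ≠ 0) (hg_int : ∫⁻ x, g x ^ ξ ≠ ∞)
    (H : ℝ≥0∞) (y : Loc d) :
    ∫⁻ m : Mark, P {ω | shotNoise g (Φ ω) y ≤ ENNReal.ofReal m * H} ∂Gξ ξ ≤
      H ^ ξ / ∫⁻ x, g x ^ ξ := by
  rcases eq_or_ne H 0 with rfl | hH
  · have hzero : P {ω | shotNoise g (Φ ω) y ≤ 0} = 0 := by
      simpa only [ae_iff, not_lt] using hΦ.ae_shotNoise_pos_at hξ hg hg_pos hg_int y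
    simp [-nonpos_iff_eq_zero, hzero]
  rcases eq_or_ne H ∞ with rfl | hH_top
  · rw [ENNReal.top_rpow_of_pos hξ, ENNReal.top_div_of_ne_top hg_int]
    exact le_top
  · exact (hΦ.lintegral_measure_shotNoise_le_mul hξ hg hg_pos hg_int hH hH_top y).le

end IsPoissonPointProcess

end FrechetMarginals

section Stationarity

variable {d : ℕ} {ξ : ℝ} {h : Loc d → ℝ≥0∞}

lemma measurable_hPlus (hh : Continuous h) : Measurable (hPlus h) :=
  (lowerSemicontinuous_biSup fun _ _ =>
    (hh.comp (continuous_id.add continuous_const)).lowerSemicontinuous).measurable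

lemma le_hPlus {x y : Loc d} (hxy : dist x y ≤ 1) : h x ≤ hPlus h y :=
  le_iSup₂_of_le (x - y) (by rwa [← dist_eq_norm]) (by rw [add_sub_cancel])

lemma lintegral_rpow_ne_top (hξ : 0 < ξ) (hplus : ∫⁻ x, hPlus h x ^ ξ ≠ ∞) :
    ∫⁻ x, h x ^ ξ ≠ ∞ :=
  ne_top_of_le_ne_top hplus <| lintegral_mono fun x =>
    ENNReal.rpow_le_rpow (le_hPlus (by simp)) hξ.le

lemma ne_top_of_lintegral_hPlus_ne_top (hξ : 0 < ξ) (hplus : ∫⁻ x, hPlus h x ^ ξ ≠ ∞)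
    (x : Loc d) : h x ≠ ∞ := by
  intro hx
  refine hplus (top_unique ?_)
  calc ∞ = ∫⁻ _ in Metric.ball x 1, ∞ := by
        rw [setLIntegral_const, ENNReal.top_mul (Metric.measure_ball_pos _ _ one_pos).ne']
    _ ≤ ∫⁻ y in Metric.ball x 1, hPlus h y ^ ξ := by
        refine setLIntegral_mono' measurableSet_ball fun y hy => ?_
        rw [← ENNReal.top_rpow_of_pos hξ, ← hx]
        exact ENNReal.rpow_le_rpow (le_hPlus (Metric.mem_ball'.1 hy).le) hξ.le
    _ ≤ ∫⁻ y, hPlus h y ^ ξ := setLIntegral_le_lintegral _ _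

lemma intensity_highShots_ne_top (hξ : 0 < ξ) (hh : Continuous h)
    (hplus : ∫⁻ x, hPlus h x ^ ξ ≠ ∞) (n j : ℕ) : intensity d ξ (highShots h n j) ≠ ∞ := by
  obtain ⟨t, -, ht_fin, ht⟩ := (isCompact_closedBall (0 : Loc d) n).finite_cover_balls one_pos
  have hsub : highShots h n j ⊆ ⋃ y ∈ t, {φ | (j : ℝ≥0∞)⁻¹ < shot (hPlus h) φ y} := by
    rintro φ ⟨y, hy, hφ⟩
    obtain ⟨z, hz, hyz⟩ := Set.mem_iUnion₂.1 (ht hy)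
    refine Set.mem_iUnion₂.2 ⟨z, hz, hφ.trans_le (mul_le_mul_right (le_hPlus ?_) _)⟩
    rw [dist_sub_right]
    exact (Metric.mem_ball.1 hyz).le
  refine ((measure_mono hsub).trans_lt (measure_biUnion_lt_top ht_fin fun y _ => ?_)).ne
  rw [intensity_lt_shot hξ (measurable_hPlus hh)]
  exact ENNReal.div_lt_top hplus (by simp [ENNReal.rpow_eq_zero_iff, hξ.not_gt])

namespace IsPoissonPointProcess

variable {Ω : Type*} [MeasurableSpace Ω] {P : Measure Ω} {Φ : Ω → Config (Loc d × Mark)}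

lemma ae_tame (hΦ : IsPoissonPointProcess P (intensity d ξ) Φ) (hξ : 0 < ξ) (hh : Continuous h)
    (hplus : ∫⁻ x, hPlus h x ^ ξ ≠ ∞) : ∀ᵐ ω ∂P, Tame h (Φ ω) := by
  simp only [Tame, ae_all_iff]
  exact fun n j => hΦ.ae_count_ne_top (measurableSet_highShots hh n j)
    (intensity_highShots_ne_top hξ hh hplus n j)

lemma ae_map_tame (hΦ : IsPoissonPointProcess P (intensity d ξ) Φ) (hξ : 0 < ξ)
    (hh : Continuous h) (hplus : ∫⁻ x, hPlus h x ^ ξ ≠ ∞) : ∀ᵐ s ∂P.map Φ, Tame h s :=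
  (ae_map_iff hΦ.measurable.aemeasurable (measurableSet_tame hh)).2 (hΦ.ae_tame hξ hh hplus)

lemma translate (hΦ : IsPoissonPointProcess P (intensity d ξ) Φ) (z : Loc d) :
    IsPoissonPointProcess P (intensity d ξ) fun ω => (Φ ω).translate z := by
  have hshift : MeasurePreserving (fun φ : Loc d × Mark => (φ.1 + z, φ.2))
      (intensity d ξ) (intensity d ξ) :=
    (measurePreserving_add_right volume z).prod (MeasurePreserving.id _)
  refine ⟨(Config.measurable_translate z).comp hΦ.measurable, fun A hA hμA => ?_,
    fun n A hA hdisj => ?_⟩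
  · simp_rw [Config.count_translate]
    rw [← hshift.measure_preimage hA.nullMeasurableSet] at hμA ⊢
    exact hΦ.poisson _ (hshift.measurable hA) hμA
  · simp_rw [Config.count_translate]
    exact hΦ.indep n _ (fun i => hshift.measurable (hA i)) fun i j hij => (hdisj hij).preimage _

variable [IsProbabilityMeasure P]

lemma identDistrib_translate (hΦ : IsPoissonPointProcess P (intensity d ξ) Φ) (z : Loc d) :
    IdentDistrib (fun ω => (Φ ω).translate z) Φ P P :=
  ⟨(hΦ.translate z).measurable.aemeasurable, hΦ.measurable.aemeasurable,
    (hΦ.translate z).map_eq_map hΦ⟩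

lemma measure_exceedSet_zero (hΦ : IsPoissonPointProcess P (intensity d ξ) Φ) (hξ : 0 < ξ)
    (hh : Continuous h) (hplus : ∫⁻ x, hPlus h x ^ ξ ≠ ∞) (m : Mark) :
    P {ω | ((0, m), Φ ω) ∈ exceedSet h} = exceedProb P h Φ m := by
  have hmeas : MeasurableSet {ω | ((0, m), Φ ω) ∈ exceedSet h} :=
    (measurable_const.prodMk hΦ.measurable) (measurableSet_exceedSet hh)
  have hcompl : {ω | ∀ y, ENNReal.ofReal (m : ℝ) * h y ≤ shotNoise h (Φ ω) y} =ᵐ[P]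
      ({ω | ((0, m), Φ ω) ∈ exceedSet h}ᶜ : Set Ω) := by
    refine Filter.eventuallyEq_set.2 ?_
    filter_upwards [hΦ.ae_tame hξ hh hplus] with ω hω
    simp [exceedSet, hω, shot]
  rw [exceedProb, measure_congr hcompl, prob_compl_eq_one_sub hmeas,
    ENNReal.sub_sub_cancel ENNReal.one_ne_top prob_le_one]

lemma measure_exceedSet (hΦ : IsPoissonPointProcess P (intensity d ξ) Φ) (hξ : 0 < ξ)
    (hh : Continuous h) (hplus : ∫⁻ x, hPlus h x ^ ξ ≠ ∞) (φ : Loc d × Mark) :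
    P {ω | (φ, Φ ω) ∈ exceedSet h} = exceedProb P h Φ φ.2 := by
  have hshift : {ω | (φ, Φ ω) ∈ exceedSet h} =ᵐ[P]
      {ω | ((0, φ.2), (Φ ω).translate (-φ.1)) ∈ exceedSet h} := by
    refine Filter.eventuallyEq_set.2 ?_
    filter_upwards [hΦ.ae_tame hξ hh hplus, (hΦ.translate (-φ.1)).ae_tame hξ hh hplus] with ω hω hω'
    refine (and_iff_right hω).trans (Iff.trans ?_ (and_iff_right hω').symm)
    refine (Equiv.subRight φ.1).exists_congr fun y => ?_
    simp [shotNoise_translate, shot]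
  rw [measure_congr hshift, ← hΦ.measure_exceedSet_zero hξ hh hplus]
  exact (hΦ.identDistrib_translate (-φ.1)).measure_mem_eq
    (measurable_prodMk_left (measurableSet_exceedSet hh))

lemma measurable_exceedProb (hΦ : IsPoissonPointProcess P (intensity d ξ) Φ) (hξ : 0 < ξ)
    (hh : Continuous h) (hplus : ∫⁻ x, hPlus h x ^ ξ ≠ ∞) : Measurable (exceedProb P h Φ) := by
  rw [← funext (hΦ.measure_exceedSet_zero hξ hh hplus)]
  have hpair : Measurable fun p : Mark × Ω => (((0 : Loc d), p.1), Φ p.2) :=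
    (measurable_const.prodMk measurable_fst).prodMk (hΦ.measurable.comp measurable_snd)
  exact measurable_measure_prodMk_left (hpair (measurableSet_exceedSet hh))

end IsPoissonPointProcess

end Stationarity

section Intensity

variable {d : ℕ} {ξ : ℝ} {g h : Loc d → ℝ≥0∞}

lemma exists_minorant (hξ : 0 < ξ) (hh : Continuous h) (h_ne : h ≠ 0) :
    ∃ g : Loc d → ℝ≥0∞, Measurable g ∧ ∫⁻ x, g x ^ ξ ≠ 0 ∧ ∫⁻ x, g x ^ ξ ≠ ∞ ∧
      ∃ δ, 0 < δ ∧ δ ≤ 1 ∧ ∀ x y, dist x y < δ → g x ≤ h y := by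
  obtain ⟨x₀, hx₀⟩ := Function.ne_iff.1 h_ne
  obtain ⟨c, hc, hcx₀⟩ := exists_between (pos_iff_ne_zero.2 hx₀)
  obtain ⟨ε, hε, hball⟩ := Metric.isOpen_iff.1 (isOpen_lt continuous_const hh) x₀ hcx₀
  have hint : ∫⁻ x, (Metric.ball x₀ (ε / 2)).indicator (fun _ => c) x ^ ξ =
      c ^ ξ * volume (Metric.ball x₀ (ε / 2)) := by
    rw [← lintegral_indicator_const measurableSet_ball]
    refine lintegral_congr fun x => ?_
    by_cases hx : x ∈ Metric.ball x₀ (ε / 2) <;> simp [hx, hξ]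
  refine ⟨(Metric.ball x₀ (ε / 2)).indicator fun _ => c,
    measurable_const.indicator measurableSet_ball, ?_, ?_, min (ε / 2) 1, by positivity,
    min_le_right _ _, fun x y hxy => ?_⟩
  · rw [hint]
    exact mul_ne_zero (ENNReal.rpow_pos hc hcx₀.ne_top).ne'
      (Metric.measure_ball_pos _ _ (half_pos hε)).ne'
  · rw [hint]
    exact ENNReal.mul_ne_top (ENNReal.rpow_ne_top_of_nonneg hξ.le hcx₀.ne_top)
      measure_ball_lt_top.ne
  · refine Set.indicator_apply_le' (fun hx => ?_) fun _ => zero_le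
    have hy : y ∈ Metric.ball x₀ ε := by
      calc dist y x₀ ≤ dist y x + dist x x₀ := dist_triangle _ _ _
        _ < ε / 2 + ε / 2 := add_lt_add (dist_comm x y ▸ hxy.trans_le (min_le_left _ _)) hx
        _ = ε := add_halves ε
    exact (show c < h y from hball hy).le

lemma shotNoise_le_shotNoise_of_dist_lt {δ : ℝ} (hgh : ∀ x y, dist x y < δ → g x ≤ h y)
    (s : Config (Loc d × Mark)) {y y' : Loc d} (hy : dist y y' < δ) :
    shotNoise g s y ≤ shotNoise h s y' :=
  shotNoise_le_shotNoise (fun x => hgh _ _ (by rwa [dist_sub_right])) s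

namespace IsPoissonPointProcess

variable {Ω : Type*} [MeasurableSpace Ω] {P : Measure Ω} {Φ : Ω → Config (Loc d × Mark)}

lemma ae_shotNoise_pos (hΦ : IsPoissonPointProcess P (intensity d ξ) Φ) (hξ : 0 < ξ)
    (hh : Continuous h) (h_ne : h ≠ 0) : ∀ᵐ ω ∂P, ∀ y, 0 < shotNoise h (Φ ω) y := by
  obtain ⟨g, hg, hg_pos, hg_int, δ, hδ, -, hgh⟩ := exists_minorant hξ hh h_ne
  have hdense : ∀ᵐ ω ∂P, ∀ i, 0 < shotNoise g (Φ ω) (TopologicalSpace.denseSeq (Loc d) i) :=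
    ae_all_iff.2 fun i => hΦ.ae_shotNoise_pos_at hξ hg hg_pos hg_int _
  filter_upwards [hdense] with ω hω y
  obtain ⟨i, hi⟩ := (TopologicalSpace.denseRange_denseSeq (Loc d)).exists_mem_open
    Metric.isOpen_ball ⟨y, Metric.mem_ball_self hδ⟩
  exact (hω i).trans_le (shotNoise_le_shotNoise_of_dist_lt hgh _ hi)

lemma measurableSet_shotNoise_le_mul (hΦ : IsPoissonPointProcess P (intensity d ξ) Φ)
    (hg : Measurable g) (hh : Measurable h) :
    MeasurableSet {q : (Mark × Loc d) × Ω |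
      shotNoise g (Φ q.2) q.1.2 ≤ ENNReal.ofReal q.1.1 * h q.1.2} :=
  measurableSet_le ((measurable_shotNoise hg).comp
    ((hΦ.measurable.comp measurable_snd).prodMk (measurable_snd.comp measurable_fst)))
    (by fun_prop)

variable [IsProbabilityMeasure P]

lemma exceedProb_pos (hΦ : IsPoissonPointProcess P (intensity d ξ) Φ) (hξ : 0 < ξ)
    (hh : Continuous h) (h_ne : h ≠ 0) (hplus : ∫⁻ x, hPlus h x ^ ξ ≠ ∞) (m : Mark) :
    0 < exceedProb P h Φ m := by
  obtain ⟨x₀, hx₀⟩ := Function.ne_iff.1 h_ne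
  have hm : 0 < ENNReal.ofReal (m : ℝ) * h x₀ :=
    ENNReal.mul_pos (ENNReal.ofReal_pos.2 m.2).ne' hx₀
  obtain ⟨t, ht, htx₀⟩ := exists_between hm
  calc 0 < P {ω | shotNoise h (Φ ω) x₀ ≤ t} := by
        rw [hΦ.measure_shotNoise_le hξ hh.measurable (lintegral_rpow_ne_top hξ hplus) ht.ne']
        exact ENNReal.ofReal_pos.2 (Real.exp_pos _)
    _ ≤ P {ω | ((0, m), Φ ω) ∈ exceedSet h} := by
        refine measure_mono_ae ?_
        filter_upwards [hΦ.ae_tame hξ hh hplus] with ω hω hle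
        exact ⟨hω, x₀, by simpa [shot] using lt_of_le_of_lt hle htx₀⟩
    _ = exceedProb P h Φ m := hΦ.measure_exceedSet_zero hξ hh hplus m

lemma extremalIntensity_pos (hΦ : IsPoissonPointProcess P (intensity d ξ) Φ) (hξ : 0 < ξ)
    (hh : Continuous h) (h_ne : h ≠ 0) (hplus : ∫⁻ x, hPlus h x ^ ξ ≠ ∞) :
    0 < extremalIntensity P ξ h Φ := by
  have hsupport : Function.support (exceedProb P h Φ) = Set.univ :=
    Set.eq_univ_of_forall fun m => (hΦ.exceedProb_pos hξ hh h_ne hplus m).ne'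
  rw [extremalIntensity, lintegral_pos_iff_support (hΦ.measurable_exceedProb hξ hh hplus),
    hsupport, Gξ_univ hξ]
  exact ENNReal.zero_lt_top

/-- If `m h` exceeds `M_h` at `y₀`, then `M_g ≤ M_h(y₀) < m h(y₀) ≤ m h⁺` on the ball of radius `δ`
about `y₀`. -/
lemma exceedProb_mul_volume_ball_le (hΦ : IsPoissonPointProcess P (intensity d ξ) Φ) (hξ : 0 < ξ)
    (hh : Continuous h) (hplus : ∫⁻ x, hPlus h x ^ ξ ≠ ∞) (hg : Measurable g) {δ : ℝ}
    (hδ : δ ≤ 1) (hgh : ∀ x y, dist x y < δ → g x ≤ h y) (m : Mark) :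
    exceedProb P h Φ m * volume (Metric.ball (0 : Loc d) δ) ≤
      ∫⁻ y, P {ω | shotNoise g (Φ ω) y ≤ ENNReal.ofReal m * hPlus h y} := by
  have hexceed : MeasurableSet {ω | ((0, m), Φ ω) ∈ exceedSet h} :=
    (measurable_const.prodMk hΦ.measurable) (measurableSet_exceedSet hh)
  have hlow : MeasurableSet {p : Loc d × Ω |
      shotNoise g (Φ p.2) p.1 ≤ ENNReal.ofReal m * hPlus h p.1} :=
    ((measurable_const.prodMk measurable_fst).prodMk measurable_snd :
      Measurable fun p : Loc d × Ω => ((m, p.1), p.2))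
      (hΦ.measurableSet_shotNoise_le_mul hg (measurable_hPlus hh))
  have hball (ω : Ω) (hω : ((0, m), Φ ω) ∈ exceedSet h) :
      volume (Metric.ball (0 : Loc d) δ) ≤
        volume {y | shotNoise g (Φ ω) y ≤ ENNReal.ofReal m * hPlus h y} := by
    obtain ⟨-, y₀, hy₀⟩ := hω
    rw [← Measure.addHaar_ball_center volume y₀]
    refine measure_mono fun y hy => ?_
    calc shotNoise g (Φ ω) y ≤ shotNoise h (Φ ω) y₀ :=
          shotNoise_le_shotNoise_of_dist_lt hgh _ hy
      _ ≤ ENNReal.ofReal m * h y₀ := by simpa [shot] using hy₀.le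
      _ ≤ ENNReal.ofReal m * hPlus h y :=
          mul_le_mul_right (le_hPlus ((Metric.mem_ball'.1 hy).le.trans hδ)) _
  calc exceedProb P h Φ m * volume (Metric.ball (0 : Loc d) δ)
      = ∫⁻ ω, {ω | ((0, m), Φ ω) ∈ exceedSet h}.indicator
          (fun _ => volume (Metric.ball (0 : Loc d) δ)) ω ∂P := by
        rw [lintegral_indicator_const hexceed, hΦ.measure_exceedSet_zero hξ hh hplus, mul_comm]
    _ ≤ ∫⁻ ω, volume {y | shotNoise g (Φ ω) y ≤ ENNReal.ofReal m * hPlus h y} ∂P :=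
        lintegral_mono (Set.indicator_le hball)
    _ = ∫⁻ y, P {ω | shotNoise g (Φ ω) y ≤ ENNReal.ofReal m * hPlus h y} :=
        (Measure.prod_apply_symm hlow).symm.trans (Measure.prod_apply hlow)

lemma extremalIntensity_mul_volume_ball_le (hΦ : IsPoissonPointProcess P (intensity d ξ) Φ)
    (hξ : 0 < ξ) (hh : Continuous h) (hplus : ∫⁻ x, hPlus h x ^ ξ ≠ ∞) (hg : Measurable g)
    (hg_pos : ∫⁻ x, g x ^ ξ ≠ 0) (hg_int : ∫⁻ x, g x ^ ξ ≠ ∞) {δ : ℝ}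
    (hδ : δ ≤ 1) (hgh : ∀ x y, dist x y < δ → g x ≤ h y) :
    extremalIntensity P ξ h Φ * volume (Metric.ball (0 : Loc d) δ) ≤
      (∫⁻ x, hPlus h x ^ ξ) / ∫⁻ x, g x ^ ξ := by
  have hmeas : Measurable fun q : Mark × Loc d =>
      P {ω | shotNoise g (Φ ω) q.2 ≤ ENNReal.ofReal q.1 * hPlus h q.2} :=
    measurable_measure_prodMk_left
      (hΦ.measurableSet_shotNoise_le_mul hg (measurable_hPlus hh))
  calc extremalIntensity P ξ h Φ * volume (Metric.ball (0 : Loc d) δ)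
      = ∫⁻ m, exceedProb P h Φ m * volume (Metric.ball (0 : Loc d) δ) ∂Gξ ξ :=
        (lintegral_mul_const _ (hΦ.measurable_exceedProb hξ hh hplus)).symm
    _ ≤ ∫⁻ m : Mark, (∫⁻ y, P {ω | shotNoise g (Φ ω) y ≤ ENNReal.ofReal m * hPlus h y}) ∂Gξ ξ :=
        lintegral_mono fun m => hΦ.exceedProb_mul_volume_ball_le hξ hh hplus hg hδ hgh m
    _ = ∫⁻ y, ∫⁻ m : Mark, P {ω | shotNoise g (Φ ω) y ≤ ENNReal.ofReal m * hPlus h y} ∂Gξ ξ :=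
        lintegral_lintegral_swap hmeas.aemeasurable
    _ ≤ ∫⁻ y, hPlus h y ^ ξ / ∫⁻ x, g x ^ ξ :=
        lintegral_mono fun y =>
          hΦ.lintegral_measure_shotNoise_le_mul_le hξ hg hg_pos hg_int (hPlus h y) y
    _ = (∫⁻ x, hPlus h x ^ ξ) / ∫⁻ x, g x ^ ξ := by
        simp_rw [div_eq_mul_inv]
        exact lintegral_mul_const' _ _ (ENNReal.inv_ne_top.2 hg_pos)

lemma extremalIntensity_lt_top (hΦ : IsPoissonPointProcess P (intensity d ξ) Φ) (hξ : 0 < ξ)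
    (hh : Continuous h) (h_ne : h ≠ 0) (hplus : ∫⁻ x, hPlus h x ^ ξ ≠ ∞) :
    extremalIntensity P ξ h Φ < ∞ := by
  obtain ⟨g, hg, hg_pos, hg_int, δ, hδ, hδ_one, hgh⟩ := exists_minorant hξ hh h_ne
  have hle := hΦ.extremalIntensity_mul_volume_ball_le hξ hh hplus hg hg_pos hg_int hδ_one hgh
  exact ENNReal.lt_top_of_mul_ne_top_left
    (ne_top_of_le_ne_top (ENNReal.div_ne_top hplus hg_pos) hle)
    (Metric.measure_ball_pos _ _ hδ).ne'

end IsPoissonPointProcess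

end Intensity

section Campbell

variable {Ω : Type*} [MeasurableSpace Ω] {P : Measure Ω}

lemma ae_finite_of_campbell_ne_top {X : Type*} [TopologicalSpace X] [MeasurableSpace X]
    {Ψ : Ω → Config X} (hΨ : AEMeasurable Ψ P) {A : Set X} (hA : MeasurableSet A)
    (hC : campbell P Ψ A ≠ ∞) : ∀ᵐ ω ∂P, ((Ψ ω).1 ∩ A).Finite := by
  have hcount : AEMeasurable (fun ω => ((Ψ ω).count A : ℝ≥0∞)) P :=
    (measurable_of_countable _).comp_aemeasurable
      ((Config.measurable_count hA).comp_aemeasurable hΨ)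
  filter_upwards [ae_lt_top' hcount hC] with ω hω
  exact Set.encard_lt_top_iff.1 (ENat.toENNReal_lt_top.1 hω)

variable {d : ℕ} {ξ : ℝ} {h : Loc d → ℝ≥0∞}

lemma ae_forall_isBounded_finite {Ψ : Ω → Config (Loc d × Mark)} (hΨ : AEMeasurable Ψ P)
    (hC : ∀ r, campbell P Ψ (Metric.closedBall 0 r ×ˢ Set.univ) ≠ ∞) :
    ∀ᵐ ω ∂P, ∀ B : Set (Loc d), Bornology.IsBounded B → ((Ψ ω).1 ∩ B ×ˢ Set.univ).Finite := by
  have hballs : ∀ᵐ ω ∂P, ∀ n : ℕ,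
      ((Ψ ω).1 ∩ Metric.closedBall (0 : Loc d) n ×ˢ Set.univ).Finite :=
    ae_all_iff.2 fun n => ae_finite_of_campbell_ne_top hΨ
      (measurableSet_closedBall.prod MeasurableSet.univ) (hC n)
  filter_upwards [hballs] with ω hω B hB
  obtain ⟨r, hr⟩ := hB.subset_closedBall 0
  obtain ⟨n, hn⟩ := exists_nat_ge r
  exact (hω n).subset (Set.inter_subset_inter_right _
    (Set.prod_mono_left (hr.trans (Metric.closedBall_subset_closedBall hn))))

lemma intensity_touchSet_sdiff_exceedSet (hh : Continuous h) (h_top : ∀ x, h x ≠ ∞)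
    {s : Config (Loc d × Mark)} (hpos : ∀ y, 0 < shotNoise h s y) :
    intensity d ξ ((fun φ => (φ, s)) ⁻¹' (touchSet h \ exceedSet h)) = 0 := by
  have hmeas : MeasurableSet ((fun φ => (φ, s)) ⁻¹' (touchSet h \ exceedSet h)) :=
    measurable_prodMk_right ((measurableSet_touchSet hh h_top).diff (measurableSet_exceedSet hh))
  refine (Measure.measure_prod_null hmeas).2 (ae_of_all _ fun x => ?_)
  have hle (m m' : Mark) (hm : ((x, m), s) ∈ touchSet h) (hm' : ((x, m'), s) ∉ exceedSet h) :
      m' ≤ m := by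
    by_contra! hlt
    obtain ⟨hs, y, hy⟩ := hm
    have hy_pos : h (y - x) ≠ 0 := right_ne_zero_of_mul ((hpos y).trans_le hy).ne'
    refine hm' ⟨hs, y, hy.trans_lt (ENNReal.mul_lt_mul_left hy_pos (h_top _) ?_)⟩
    exact (ENNReal.ofReal_lt_ofReal_iff m'.2).2 hlt
  have hsubsingleton :
      (Prod.mk x ⁻¹' ((fun φ => (φ, s)) ⁻¹' (touchSet h \ exceedSet h))).Subsingleton :=
    fun m hm m' hm' => le_antisymm (hle m' m hm'.1 hm.2) (hle m m' hm.1 hm'.2)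
  exact hsubsingleton.measure_zero _

lemma extremalIntensity_smul_prod_extremalMarkLaw {Φ : Ω → Config (Loc d × Mark)}
    (hmeas : Measurable (exceedProb P h Φ)) (h_ne : extremalIntensity P ξ h Φ ≠ 0)
    (h_top : extremalIntensity P ξ h Φ ≠ ∞) :
    extremalIntensity P ξ h Φ • (volume : Measure (Loc d)).prod (extremalMarkLaw P ξ h Φ) =
      (intensity d ξ).withDensity fun φ => exceedProb P h Φ φ.2 := by
  have : IsFiniteMeasure ((Gξ ξ).withDensity (exceedProb P h Φ)) :=
    isFiniteMeasure_withDensity h_top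
  rw [extremalMarkLaw, Measure.prod_smul_right, smul_smul, ENNReal.mul_inv_cancel h_ne h_top,
    one_smul, prod_withDensity_right hmeas]

lemma isProbabilityMeasure_extremalMarkLaw {Φ : Ω → Config (Loc d × Mark)}
    (h_ne : extremalIntensity P ξ h Φ ≠ 0) (h_top : extremalIntensity P ξ h Φ ≠ ∞) :
    IsProbabilityMeasure (extremalMarkLaw P ξ h Φ) := by
  refine ⟨?_⟩
  rw [extremalMarkLaw, Measure.smul_apply, withDensity_apply _ MeasurableSet.univ,
    Measure.restrict_univ]
  exact ENNReal.inv_mul_cancel h_ne h_top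

namespace IsPoissonPointProcess

variable [IsProbabilityMeasure P] {Φ : Ω → Config (Loc d × Mark)}

lemma touchSet_ae_eq_exceedSet (hΦ : IsPoissonPointProcess P (intensity d ξ) Φ) (hξ : 0 < ξ)
    (hh : Continuous h) (h_ne : h ≠ 0) (hplus : ∫⁻ x, hPlus h x ^ ξ ≠ ∞) :
    touchSet h =ᵐ[(intensity d ξ).prod (P.map Φ)] exceedSet h := by
  have h_top := ne_top_of_lintegral_hPlus_ne_top hξ hplus
  have hsub : exceedSet h ⊆ touchSet h := fun p hp => ⟨hp.1, hp.2.imp fun y hy => hy.le⟩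
  have hmeas : MeasurableSet (touchSet h \ exceedSet h) :=
    (measurableSet_touchSet hh h_top).diff (measurableSet_exceedSet hh)
  have := Measure.isProbabilityMeasure_map (μ := P) hΦ.measurable.aemeasurable
  refine (ae_le_set.2 ?_).antisymm hsub.eventuallyLE
  rw [Measure.prod_apply_symm hmeas,
    lintegral_map (measurable_measure_prodMk_right hmeas) hΦ.measurable]
  refine lintegral_eq_zero_of_ae_eq_zero ?_
  filter_upwards [hΦ.ae_shotNoise_pos hξ hh h_ne] with ω hpos
  exact intensity_touchSet_sdiff_exceedSet hh h_top hpos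

lemma campbell_extremal (hΦ : IsPoissonPointProcess P (intensity d ξ) Φ) (hξ : 0 < ξ)
    (hh : Continuous h) (h_ne : h ≠ 0) (hplus : ∫⁻ x, hPlus h x ^ ξ ≠ ∞)
    {A : Set (Loc d × Mark)} (hA : MeasurableSet A) :
    campbell P (fun ω => extremal h (Φ ω)) A =
      (intensity d ξ).withDensity (fun φ => exceedProb P h Φ φ.2) A := by
  have h_top := ne_top_of_lintegral_hPlus_ne_top hξ hplus
  have htame := hΦ.ae_map_tame hξ hh hplus
  have := Measure.isProbabilityMeasure_map (μ := P) hΦ.measurable.aemeasurable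
  have hexceed := measurableSet_exceedSet hh
  calc campbell P (fun ω => extremal h (Φ ω)) A
      = ∫⁻ s, ((extremal h s).count A : ℝ≥0∞) ∂P.map Φ :=
        (lintegral_map' ((measurable_of_countable _).comp_aemeasurable
          ((Config.measurable_count hA).comp_aemeasurable
            (aemeasurable_extremal hh h_top htame))) hΦ.measurable.aemeasurable).symm
    _ = ∫⁻ s, (s.count {φ | (φ, s.erase φ) ∈ Prod.fst ⁻¹' A ∩ touchSet h} : ℝ≥0∞) ∂P.map Φ :=
        lintegral_congr_ae (htame.mono fun s hs => congrArg _ (hs.count_extremal A))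
    _ = reducedCampbell (P.map Φ) (Prod.fst ⁻¹' A ∩ touchSet h) :=
        (reducedCampbell_apply _ ((measurable_fst hA).inter (measurableSet_touchSet hh h_top))).symm
    _ = (intensity d ξ).prod (P.map Φ) (exceedSet h ∩ A ×ˢ Set.univ) := by
        rw [hΦ.mecke, Set.inter_comm, Set.prod_univ]
        exact measure_congr
          ((hΦ.touchSet_ae_eq_exceedSet hξ hh h_ne hplus).inter (ae_eq_refl _))
    _ = ∫⁻ φ in A, P.map Φ (Prod.mk φ ⁻¹' exceedSet h) ∂intensity d ξ := by
        rw [← Measure.restrict_apply hexceed, ← Measure.prod_restrict, Measure.restrict_univ,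
          Measure.prod_apply hexceed]
    _ = ∫⁻ φ in A, exceedProb P h Φ φ.2 ∂intensity d ξ :=
        lintegral_congr fun φ =>
          (Measure.map_apply hΦ.measurable (measurable_prodMk_left hexceed)).trans
            (hΦ.measure_exceedSet hξ hh hplus φ)
    _ = (intensity d ξ).withDensity (fun φ => exceedProb P h Φ φ.2) A :=
        (withDensity_apply _ hA).symm

lemma campbell_extremal_eq_smul_prod (hΦ : IsPoissonPointProcess P (intensity d ξ) Φ)
    (hξ : 0 < ξ) (hh : Continuous h) (h_ne : h ≠ 0) (hplus : ∫⁻ x, hPlus h x ^ ξ ≠ ∞)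
    {A : Set (Loc d × Mark)} (hA : MeasurableSet A) :
    campbell P (fun ω => extremal h (Φ ω)) A =
      (extremalIntensity P ξ h Φ •
        (volume : Measure (Loc d)).prod (extremalMarkLaw P ξ h Φ)) A := by
  rw [hΦ.campbell_extremal hξ hh h_ne hplus hA, extremalIntensity_smul_prod_extremalMarkLaw
    (hΦ.measurable_exceedProb hξ hh hplus) (hΦ.extremalIntensity_pos hξ hh h_ne hplus).ne'
    (hΦ.extremalIntensity_lt_top hξ hh h_ne hplus).ne]

lemma isStationaryMarkedPointProcess_extremal (hΦ : IsPoissonPointProcess P (intensity d ξ) Φ)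
    (hξ : 0 < ξ) (hh : Continuous h) (h_ne : h ≠ 0) (hplus : ∫⁻ x, hPlus h x ^ ξ ≠ ∞) :
    IsStationaryMarkedPointProcess P fun ω => extremal h (Φ ω) := by
  have hextremal : AEMeasurable (extremal h) (P.map Φ) :=
    aemeasurable_extremal hh (ne_top_of_lintegral_hPlus_ne_top hξ hplus)
      (hΦ.ae_map_tame hξ hh hplus)
  have hΨ : AEMeasurable (fun ω => extremal h (Φ ω)) P :=
    hextremal.comp_aemeasurable hΦ.measurable.aemeasurable
  have h_lt_top := hΦ.extremalIntensity_lt_top hξ hh h_ne hplus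
  refine ⟨hΨ, ae_forall_isBounded_finite hΨ fun r => ?_, fun z => ?_⟩
  · have := isProbabilityMeasure_extremalMarkLaw
      (hΦ.extremalIntensity_pos hξ hh h_ne hplus).ne' h_lt_top.ne
    rw [hΦ.campbell_extremal_eq_smul_prod hξ hh h_ne hplus
      (measurableSet_closedBall.prod MeasurableSet.univ), Measure.smul_apply, Measure.prod_prod,
      measure_univ, mul_one]
    exact ENNReal.mul_ne_top h_lt_top.ne measure_closedBall_lt_top.ne
  · have hshift := hΦ.identDistrib_translate z
    have hshift_extremal := hshift.comp_of_aemeasurable (hshift.map_eq.symm ▸ hextremal)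
    simpa only [Function.comp_def, extremal_translate] using hshift_extremal

end IsPoissonPointProcess

end Campbell

end ExtremalShotNoise

theorem proposition4p3_general {Ω : Type*} [MeasurableSpace Ω] (P : Measure Ω)
    [IsProbabilityMeasure P]
    (d : ℕ) (ξ : ℝ) (hξ : 0 < ξ)
    (h : ExtremalShotNoise.Loc d → ℝ≥0∞) (hcont : Continuous h)
    (h_ne : h ≠ 0)
    (hplus : (∫⁻ x, ExtremalShotNoise.hPlus h x ^ ξ) < ∞)
    (Φ : Ω → ExtremalShotNoise.Config (ExtremalShotNoise.Loc d × ExtremalShotNoise.Mark))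
    (hΦ : ExtremalShotNoise.IsPoissonPointProcess P
      ((volume : Measure (ExtremalShotNoise.Loc d)).prod (ExtremalShotNoise.Gξ ξ)) Φ) :
    ExtremalShotNoise.IsStationaryMarkedPointProcess P
        (fun ω => ExtremalShotNoise.extremal h (Φ ω)) ∧
      0 < ExtremalShotNoise.extremalIntensity P ξ h Φ ∧
      ExtremalShotNoise.extremalIntensity P ξ h Φ < ∞ ∧
      IsProbabilityMeasure (ExtremalShotNoise.extremalMarkLaw P ξ h Φ) ∧
      ∀ A : Set (ExtremalShotNoise.Loc d × ExtremalShotNoise.Mark), MeasurableSet A →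
        ExtremalShotNoise.campbell P (fun ω => ExtremalShotNoise.extremal h (Φ ω)) A =
          (ExtremalShotNoise.extremalIntensity P ξ h Φ •
            (volume : Measure (ExtremalShotNoise.Loc d)).prod
              (ExtremalShotNoise.extremalMarkLaw P ξ h Φ)) A := by
  have h_pos := hΦ.extremalIntensity_pos hξ hcont h_ne hplus.ne
  have h_lt_top := hΦ.extremalIntensity_lt_top hξ hcont h_ne hplus.ne
  exact ⟨hΦ.isStationaryMarkedPointProcess_extremal hξ hcont h_ne hplus.ne, h_pos, h_lt_top,
    ExtremalShotNoise.isProbabilityMeasure_extremalMarkLaw h_pos.ne' h_lt_top.ne,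
    fun _ hA => hΦ.campbell_extremal_eq_smul_prod hξ hcont h_ne hplus.ne hA⟩

theorem proposition4p3 {Ω : Type*} [MeasurableSpace Ω] (P : Measure Ω) [IsProbabilityMeasure P]
    (d : ℕ) (ξ : ℝ) (hξ : 0 < ξ)
    (h : ExtremalShotNoise.Loc d → ℝ≥0∞) (hcont : Continuous h)
    (hnorm : (∫⁻ x, h x ^ ξ) = 1)
    (hplus : (∫⁻ x, ExtremalShotNoise.hPlus h x ^ ξ) < ∞)
    (Φ : Ω → ExtremalShotNoise.Config (ExtremalShotNoise.Loc d × ExtremalShotNoise.Mark))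
    (hΦ : ExtremalShotNoise.IsPoissonPointProcess P
      ((volume : Measure (ExtremalShotNoise.Loc d)).prod (ExtremalShotNoise.Gξ ξ)) Φ) :
    ExtremalShotNoise.IsStationaryMarkedPointProcess P
        (fun ω => ExtremalShotNoise.extremal h (Φ ω)) ∧
      0 < ExtremalShotNoise.extremalIntensity P ξ h Φ ∧
      ExtremalShotNoise.extremalIntensity P ξ h Φ < ∞ ∧
      IsProbabilityMeasure (ExtremalShotNoise.extremalMarkLaw P ξ h Φ) ∧
      ∀ A : Set (ExtremalShotNoise.Loc d × ExtremalShotNoise.Mark), MeasurableSet A →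
        ExtremalShotNoise.campbell P (fun ω => ExtremalShotNoise.extremal h (Φ ω)) A =
          (ExtremalShotNoise.extremalIntensity P ξ h Φ •
            (volume : Measure (ExtremalShotNoise.Loc d)).prod
              (ExtremalShotNoise.extremalMarkLaw P ξ h Φ)) A := by
  have h_ne : h ≠ 0 := by rintro rfl; simp [hξ] at hnorm
  exact proposition4p3_general P d ξ hξ h hcont h_ne hplus Φ hΦ
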